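/- **Setting.** Let $\Bbbk$ be an algebraically closed field, $A$ a finite dimensional $\Bbbk$-algebra, $\mathfrak r=\operatorname{rad}A$, and $I\subseteq\mathfrak r$ a two-sided ideal. Let $A_1,\dots,A_t$ be a complete list of pairwise non-isomorphic indecomposable projective right $A$-modules, and for $\mathbf r=(r_1,\dots,r_t)\in\mathbb N^t$ put $\mathbf rA=\bigoplus_{i=1}^t r_iA_i$. Fix integers $m\le n$ and a vector rank $\mathbf r_\bullet=(\mathbf r_n,\mathbf r_{n-1},\dots,\mathbf r_m)$ with $\mathbf r_k\in\mathbb N^t$. Let $$\mathcal H=\bigoplus_{k=m+1}^n\operatorname{Hom}_A(\mathbf r_kA,\ \mathbf r_{k-1}A\,I),$$ let $\mathbb P(\mathcal H)$ be the projective space of lines in $\mathcal H$ with its Zariski topology, and let $\mathfrak D=\mathfrak D(\mathbf r_\bullet,I)\subseteq\mathbb P(\mathcal H)$ be the projective variety of those lines whose elements $(h_k)$ satisfy $h_kh_{k+1}=0$ for all $m<k<n$ (points mean $\Bbbk$-points). The *canonical $I$-family of complexes* over $\mathfrak D$ is the complex of sheaves $$\mathcal V_\bullet:\quad \mathcal V_n\xrightarrow{d_n}\mathcal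 V_{n-1}\xrightarrow{d_{n-1}}\cdots\to\mathcal V_m,\qquad \mathcal V_k=\mathcal O_{\mathfrak D}(n-k)\otimes_{\Bbbk}\mathbf r_kA,$$ where $d_k$ is multiplication by the tautological section $(h_k)\mapsto h_k$ of $\mathcal O_{\mathfrak D}(1)\otimes\operatorname{Hom}_A(\mathbf r_kA,\mathbf r_{k-1}A\,I)$. For a point $x\in\mathfrak D$ let $\mathcal V_\bullet(x)$ be its fibre at $x$, a complex of right $A$-modules. Explicitly, if $\ell\subset\mathcal H$ is the line $x$, then $\mathcal V_k(x)$ consists of the functions $f:\ell\setminus\{0\}\to\mathbf r_kA$ with $f(ch)=c^{\,n-k}f(h)$ for all $c\in\Bbbk^\times$, and $(d_kf)(h)=h_k(f(h))$. **Proposition 2.3.** For every integer $i\ge0$ the set $$\mathfrak D_i(\mathbf r_\bullet,I)=\bigl\{x\in\mathfrak D\ :\ \dim\{y\in\mathfrak D : \mathcal V_\bullet(y)\simeq\mathcal V_\bullet(x)\}\le i\bigr\}$$ is closed in $\mathfrak D$. Here $\simeq$ is isomorphism of complexes of right $A$-modules, and $\dim$ is the Krull dimension for the subspace Zariski topology.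 -/

import Mathlib

open CategoryTheory MulOpposite LinearAlgebra.Projectivization

universe u v w

namespace DerivedSemicont

noncomputable section

/-! ### The Zariski topology on the set of points of a projective space -/

section Zariski

variable {k : Type u} [Field k] {V : Type w} [AddCommGroup V] [Module k V]

/-- The value at a vector of `V` of a polynomial in linear forms on `V`.  Such expressions are exactly
the polynomial functions on `V`. -/
def polyEval (p : MvPolynomial (Module.Dual k V) k) (x : V) : k :=
  MvPolynomial.eval (fun φ : Module.Dual k V => φ x) p

/-- The set of points of `ℙ(V)` (lines in `V`) on which all the polynomials of `S` vanish. -/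
def projZeroLocus (S : Set (MvPolynomial (Module.Dual k V) k)) : Set (ℙ k V) :=
  {x | ∀ p ∈ S, ∀ h ∈ x.submodule, h ≠ 0 → polyEval p h = 0}

theorem eval_smul_of_isHomogeneous {σ : Type*} {p : MvPolynomial σ k} {d : ℕ}
    (hp : p.IsHomogeneous d) (c : k) (f : σ → k) :
    MvPolynomial.eval (c • f) p = c ^ d * MvPolynomial.eval f p := by
  rw [MvPolynomial.eval_eq, MvPolynomial.eval_eq, Finset.mul_sum]
  refine Finset.sum_congr rfl fun e he => ?_
  have hd : ∑ i ∈ e.support, e i = d := by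
    have := hp (MvPolynomial.mem_support_iff.mp he)
    rwa [Finsupp.weight_apply, Finsupp.sum, Finset.sum_congr rfl
      (fun i _ => by simp : ∀ i ∈ e.support, e i • (1 : σ → ℕ) i = e i)] at this
  simp only [Pi.smul_apply, smul_eq_mul, mul_pow, Finset.prod_mul_distrib,
    Finset.prod_pow_eq_pow_sum, hd]
  ring

/-- The Zariski topology of `ℙ(V)`: the closed sets are the zero loci of sets of homogeneous
polynomials. -/
instance zariskiTopology : TopologicalSpace (ℙ k V) :=
  TopologicalSpace.ofClosed
    {Z | ∃ S : Set (MvPolynomial (Module.Dual k V) k),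
      (∀ p ∈ S, ∃ d : ℕ, p.IsHomogeneous d) ∧ Z = projZeroLocus S}
    (by
      refine ⟨{1}, ?_, ?_⟩
      · rintro p rfl
        exact ⟨0, MvPolynomial.isHomogeneous_one _ _⟩
      · ext x
        simp only [Set.mem_empty_iff_false, projZeroLocus, Set.mem_ofPred_eq, false_iff]
        intro hx
        have h1 := hx 1 rfl x.rep (by
          rw [Projectivization.submodule_eq]
          exact Submodule.mem_span_singleton_self _) x.rep_nonzero
        simp [polyEval] at h1)
    (by
      intro Zs hZs
      refine ⟨{p | (∃ d : ℕ, p.IsHomogeneous d) ∧ ∃ Z ∈ Zs, Z ⊆ projZeroLocus {p}}, ?_, ?_⟩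
      · rintro p ⟨hp, -⟩
        exact hp
      · ext x
        constructor
        · rintro hx p ⟨-, Z, hZ, hpZ⟩
          exact hpZ (hx Z hZ) p rfl
        · intro hx Z hZ
          obtain ⟨S, hS, rfl⟩ := hZs hZ
          intro p hp
          refine hx p ⟨hS p hp, _, hZ, ?_⟩
          rintro y hy q rfl
          exact hy q hp)
    (by
      rintro _ ⟨S, hS, rfl⟩ _ ⟨T, hT, rfl⟩
      refine ⟨{r | ∃ p ∈ S, ∃ q ∈ T, r = p * q}, ?_, ?_⟩
      · rintro _ ⟨p, hp, q, hq, rfl⟩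
        obtain ⟨d, hd⟩ := hS p hp
        obtain ⟨e, he⟩ := hT q hq
        exact ⟨d + e, hd.mul he⟩
      · ext x
        constructor
        · rintro (hx | hx) _ ⟨p, hp, q, hq, rfl⟩ h hh h0
          · have := hx p hp h hh h0
            simp only [polyEval, map_mul] at this ⊢
            rw [this, zero_mul]
          · have := hx q hq h hh h0
            simp only [polyEval, map_mul] at this ⊢
            rw [this, mul_zero]
        · intro hx
          by_contra hcon
          simp only [Set.mem_union, not_or, projZeroLocus, Set.mem_ofPred_eq, not_forall] at hcon
          obtain ⟨⟨p, hp, h, hh, h0, hph⟩, ⟨q, hq, h', hh', h0', hqh'⟩⟩ := hcon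
          obtain ⟨e, he⟩ := hT q hq
          -- both vectors lie on the same line
          obtain ⟨c, hc⟩ : ∃ c : k, c • h = h' := by
            rw [Projectivization.submodule_eq, Submodule.mem_span_singleton] at hh hh'
            obtain ⟨a, rfl⟩ := hh
            obtain ⟨b, rfl⟩ := hh'
            have ha : a ≠ 0 := by
              rintro rfl
              exact h0 (zero_smul _ _)
            exact ⟨b * a⁻¹, by rw [smul_smul, mul_assoc, inv_mul_cancel₀ ha, mul_one]⟩
          have hqh : polyEval q h ≠ 0 := by
            intro hz
            apply hqh'
            have hsc : polyEval q (c • h) = c ^ e * polyEval q h := by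
              unfold polyEval
              have : (fun φ : Module.Dual k V => φ (c • h)) =
                  c • fun φ : Module.Dual k V => φ h := by
                funext φ
                simp
              rw [this]
              exact eval_smul_of_isHomogeneous he c _
            rw [← hc, hsc, hz, mul_zero]
          have := hx _ ⟨p, hp, q, hq, rfl⟩ h hh h0
          simp only [polyEval, map_mul, mul_eq_zero] at this
          exact this.elim hph hqh)

end Zariski

/-! ### Projective modules.  Right `A`-modules are modules over `Aᵐᵒᵖ`. -/

section Algebra

variable {A : Type v} [Ring A]

/-- A non-zero module without non-trivial direct sum decompositions. -/
def IsIndecomposable (R : Type v) [Ring R] (M : Type w) [AddCommGroup M] [Module R M] : Prop :=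
  Nontrivial M ∧ ∀ N N' : Submodule R M, IsCompl N N' → N = ⊥ ∨ N' = ⊥

/-- `P 1, …, P t` is a complete list of pairwise non-isomorphic indecomposable (finitely generated)
projective right `A`-modules. -/
structure IsIndecomposableProjectiveList (A : Type v) [Ring A] {t : ℕ} (P : Fin t → Type w)
    [∀ i, AddCommGroup (P i)] [∀ i, Module Aᵐᵒᵖ (P i)] : Prop where
  projective : ∀ i, Module.Projective Aᵐᵒᵖ (P i)
  finite : ∀ i, Module.Finite Aᵐᵒᵖ (P i)
  indecomposable : ∀ i, IsIndecomposable Aᵐᵒᵖ (P i)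
  eq_of_equiv : ∀ i j, Nonempty (P i ≃ₗ[Aᵐᵒᵖ] P j) → i = j
  complete : ∀ (Q : Type v) [AddCommGroup Q] [Module Aᵐᵒᵖ Q], Module.Projective Aᵐᵒᵖ Q →
    Module.Finite Aᵐᵒᵖ Q → IsIndecomposable Aᵐᵒᵖ Q → ∃ i, Nonempty (Q ≃ₗ[Aᵐᵒᵖ] P i)

/-- The module `𝔯A = ⨁ᵢ rᵢ Aᵢ` for a vector `𝔯 = (r₁, …, r_t)`, where `Aᵢ = P i`. -/
abbrev RankModule {t : ℕ} (P : Fin t → Type w) (r : Fin t → ℕ) : Type w :=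
  ∀ i, Fin (r i) → P i

/-- The submodule `MI` of a right module `M`, generated by the products `x a` with `x ∈ M`, `a ∈ I`. -/
def mulIdeal (I : Ideal A) (M : Type w) [AddCommGroup M] [Module Aᵐᵒᵖ M] : Submodule Aᵐᵒᵖ M :=
  Submodule.span Aᵐᵒᵖ {y | ∃ x : M, ∃ a ∈ I, y = op a • x}

end Algebra

section Complexes

variable (k : Type u) [Field k] {A : Type v} [Ring A] [Algebra k A]

/-- The space `Hom_A(M, NI)`, as the `k`-space of the homomorphisms `M → N` with image in `NI`. -/
def homIdeal (I : Ideal A) (M N : Type w) [AddCommGroup M] [Module Aᵐᵒᵖ M]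
    [AddCommGroup N] [Module Aᵐᵒᵖ N] [Module k N] [IsScalarTower k Aᵐᵒᵖ N] :
    Submodule k (M →ₗ[Aᵐᵒᵖ] N) where
  carrier := {f | ∀ x, f x ∈ mulIdeal I N}
  add_mem' hf hg x := add_mem (hf x) (hg x)
  zero_mem' _ := zero_mem _
  smul_mem' c f hf x := by
    have h : (c • f) x = (algebraMap k Aᵐᵒᵖ c) • f x := by
      rw [LinearMap.smul_apply, algebraMap_smul]
    rw [h]
    exact Submodule.smul_mem _ _ (hf x)

variable {t : ℕ} (P : Fin t → Type w) [∀ i, AddCommGroup (P i)] [∀ i, Module Aᵐᵒᵖ (P i)]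
  [∀ i, Module k (P i)] [∀ i, IsScalarTower k Aᵐᵒᵖ (P i)]

/-- The space `ℋ(𝔯•, I) = ⨁_{m < l ≤ n} Hom_A(𝔯_l A, 𝔯_{l-1} A I)`.  The component of index `l` is
`h_{l+1} : 𝔯_{l+1} A → 𝔯_l A I`, where `m ≤ l < n`. -/
abbrev DiffSpace (I : Ideal A) (m n : ℤ) (r : ℤ → Fin t → ℕ) : Type w :=
  ∀ l : Set.Ico m n,
    homIdeal k I (RankModule P (r ((l : ℤ) + 1))) (RankModule P (r (l : ℤ)))

variable {k P} {I : Ideal A} {m n : ℤ} {r : ℤ → Fin t → ℕ}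

/-- The homomorphism `h_{l+1} : 𝔯_{l+1} A → 𝔯_l A` of a sequence `h ∈ ℋ`, which is `0` for `l`
outside of `[m, n)`. -/
def diff (h : DiffSpace k P I m n r) (l : ℤ) :
    RankModule P (r (l + 1)) →ₗ[Aᵐᵒᵖ] RankModule P (r l) :=
  if hl : l ∈ Set.Ico m n then (h ⟨l, hl⟩).1 else 0

theorem diff_smul (c : k) (h : DiffSpace k P I m n r) (l : ℤ) :
    diff (c • h) l = c • diff h l := by
  unfold diff
  split_ifs
  · rfl
  · rw [smul_zero]

variable (k P I m n r) in
/-- The projective variety `𝔇(𝔯•, I) ⊆ ℙ(ℋ)` of the sequences with `h_{l+1} h_{l+2} = 0` for all `l`,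
up to homothety. -/
def varietyD : Set (ℙ k (DiffSpace k P I m n r)) :=
  {x | ∀ h ∈ x.submodule, ∀ l : ℤ, (diff h l).comp (diff h (l + 1)) = 0}

/-- The line `x` without the origin. -/
abbrev PuncturedLine {V : Type w} [AddCommGroup V] [Module k V] (x : ℙ k V) : Type w :=
  {h : V // h ∈ x.submodule ∧ h ≠ 0}

/-- The fibre at the point `x` of the sheaf `𝒪(j) ⊗ M` over the projective space `ℙ(V)` of lines in
`V`: the functions `f` on the punctured line `x` with values in `M`, homogeneous of degree `j`,
i.e. such that `f (c h) = c ^ j f h`.  (This is `ℓ^{⊗(-j)} ⊗ M`, where `ℓ` is the line `x`, i.e. the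
fibre of `𝒪(-1)`.) -/
def twistFibre (A : Type v) [Ring A] [Algebra k A] {V : Type w} [AddCommGroup V] [Module k V] (x : ℙ k V) (j : ℤ)
    (M : Type w) [AddCommGroup M] [Module Aᵐᵒᵖ M] [Module k M] [IsScalarTower k Aᵐᵒᵖ M] :
    Submodule Aᵐᵒᵖ (PuncturedLine x → M) where
  carrier := {f | ∀ (c : kˣ) (h h' : PuncturedLine x), (h' : V) = (c : k) • (h : V) →
    f h' = ((c ^ j : kˣ) : k) • f h}
  add_mem' hf hg c h h' e := by
    simp only [Pi.add_apply, hf c h h' e, hg c h h' e, smul_add]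
  zero_mem' c h h' _ := by simp
  smul_mem' a f hf c h h' e := by
    simp only [Pi.smul_apply, hf c h h' e]
    exact smul_comm _ _ _

/-- The fibre at `x` of the differential `𝒱_{l+1} → 𝒱_l` of the canonical family, where
`𝒱_l = 𝒪(n - l) ⊗ 𝔯_l A`: multiplication by the tautological section `h ↦ h_{l+1}` of degree `1`. -/
def canonicalDiff (x : ℙ k (DiffSpace k P I m n r)) (l : ℤ) :
    twistFibre A x (n - (l + 1)) (RankModule P (r (l + 1))) →ₗ[Aᵐᵒᵖ]
      twistFibre A x (n - l) (RankModule P (r l)) where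
  toFun f := ⟨fun h => diff h.1 l (f.1 h), by
    intro c h h' e
    have hf := f.2 c h h' e
    have hd : (c ^ (n - l) : kˣ) = c * c ^ (n - (l + 1)) := by
      rw [← zpow_one_add]
      congr 1
      ring
    change diff h'.1 l (f.1 h') = _
    rw [hf, e, diff_smul, LinearMap.smul_apply,
      LinearMap.map_smul_of_tower, smul_smul, hd, Units.val_mul]⟩
  map_add' f g := by
    ext1
    funext h
    exact map_add (diff h.1 l) (f.1 h) (g.1 h)
  map_smul' a f := by
    ext1
    funext h
    exact map_smul (diff h.1 l) a (f.1 h)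

theorem canonicalDiff_comp (x : varietyD k P I m n r) (l : ℤ) :
    (canonicalDiff x.1 l).comp (canonicalDiff x.1 (l + 1)) = 0 := by
  refine LinearMap.ext fun f => Subtype.ext (funext fun h => ?_)
  have h0 := LinearMap.congr_fun (x.2 h.1 h.2.1 l) (f.1 h)
  simpa [canonicalDiff] using h0

/-- The term `𝒱_l(x)` of the fibre of the canonical family at `x`. -/
def canonicalTerm (x : varietyD k P I m n r) (l : ℤ) : ModuleCat.{w} Aᵐᵒᵖ :=
  ModuleCat.of Aᵐᵒᵖ (twistFibre A x.1 (n - l) (RankModule P (r l)))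

/-- The differential `𝒱_{l+1}(x) → 𝒱_l(x)`. -/
def canonicalMap (x : varietyD k P I m n r) (l : ℤ) :
    canonicalTerm x (l + 1) ⟶ canonicalTerm x l :=
  ModuleCat.ofHom (canonicalDiff x.1 l)

theorem canonicalMap_comp (x : varietyD k P I m n r) (l : ℤ) :
    canonicalMap x (l + 1) ≫ canonicalMap x l = 0 :=
  ModuleCat.hom_ext (canonicalDiff_comp x l)

/-- The complex `𝒱•(𝔯•, I)(x)` of right `A`-modules: the fibre at the point `x ∈ 𝔇(𝔯•, I)` of the
canonical `I`-family `𝒱•`, with `𝒱_l = 𝒪_𝔇(n - l) ⊗ 𝔯_l A`. -/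
def canonicalFamily (x : varietyD k P I m n r) : ChainComplex (ModuleCat.{w} Aᵐᵒᵖ) ℤ :=
  ChainComplex.of (canonicalTerm x) (canonicalMap x) (canonicalMap_comp x)

end Complexes

end

end DerivedSemicont

/-! Let `W` be the product of the algebras `End(𝐫_l A)`, `m ≤ l ≤ n`, acting on `ℋ` from both sides.
Trivializing the fibres at representatives `h`, `h'` of two points, an isomorphism of complexes
becomes a unit `g` of `W` with `g h = h' g` (`nonempty_iso_canonicalFamily_iff`,
`conj_iff_exists_linearEquiv`). Multiplying the `l`-th term by `a ^ (-l)` conjugates `h` to `a h`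
(`conj_smul`), so conjugacy classes are cones and the choice of representatives is immaterial.

The key fact is that the class of `h` in the projective space has dimension `r - 1`, where `r` is
the rank of `T : w ↦ w h - h w`. The stabilizer of `h` consists of the units in the linear subspace
`ker T`, so the orbit should have dimension `r` in every characteristic. `exists_slice` makes this
explicit: take a complement `ι(k^r)` of `ker T`. For `h'` in the orbit near `h`, the equation `w h =
h' w` has exactly one solution `w = 1 + ι s`; by Cramer's rule `s` is rational in `h'`, and `h'` is
rational in `s`. Thus a neighbourhood of `h` in its orbit is an open part of `k^r`. Cutting with a
hyperplane `l = 1` gives a chart of the projective class as an open part of a hypersurface of `k^r`,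
of dimension `r - 1` (`exists_isOpen_topologicalKrullDim`).

A bound `dim ≤ i` is therefore a bound on the rank of `T`, which is a closed condition because a
nonzero minor stays nonzero nearby. -/

namespace DerivedSemicont

open Topology TopologicalSpace

/-! ### Krull dimension of topological spaces -/

/-- Take a point `x` of the smallest member of a chain of irreducible closed sets. Every member
meets the neighbourhood `U` of `x` in a dense subset of itself, so the traces on `U` are still
irreducible and strictly increasing. -/
theorem topologicalKrullDim_le_of_forall_exists_isOpen {X : Type*} [TopologicalSpace X]
    {d : WithBot ℕ∞}
    (h : ∀ x : X, ∃ U : Set X, IsOpen U ∧ x ∈ U ∧ topologicalKrullDim U ≤ d) :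
    topologicalKrullDim X ≤ d := by
  refine iSup_le fun c => ?_
  obtain ⟨x, hx⟩ := c.head.2.nonempty
  obtain ⟨U, hU, hxU, hd⟩ := h x
  refine le_trans ?_ hd
  have hmem : ∀ i, x ∈ (c i : Set X) := fun i => c.monotone (Fin.zero_le i) hx
  have hdense : ∀ i, (c i : Set X) ⊆ closure ((c i : Set X) ∩ U) := fun i =>
    subset_closure_inter_of_isPreirreducible_of_isOpen (c i).2.isPreirreducible hU
      ⟨x, hmem i, hxU⟩
  let f : Fin (c.length + 1) → IrreducibleCloseds U := fun i =>
    { carrier := (↑) ⁻¹' (c i : Set X)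
      isIrreducible' := by
        refine ⟨⟨⟨x, hxU⟩, hmem i⟩, ?_⟩
        exact (c i).2.isPreirreducible.preimage hU.isOpenEmbedding_subtypeVal
      isClosed' := (c i).3.preimage continuous_subtype_val }
  refine le_iSup_of_le (⟨c.length, f, fun i => ?_⟩ : LTSeries (IrreducibleCloseds U)) le_rfl
  have hlt := c.step i
  refine lt_of_le_of_ne (show f i.castSucc ≤ f i.succ from fun y hy =>
    (show (c i.castSucc : Set X) ⊆ c i.succ from hlt.le) hy) fun heq => ?_
  refine hlt.not_ge (show (c i.succ : Set X) ⊆ c i.castSucc from fun y hy => ?_)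
  have h1 : (c i.succ : Set X) ∩ U ⊆ c i.castSucc := by
    rintro z ⟨hz, hzU⟩
    have : (⟨z, hzU⟩ : U) ∈ f i.succ := hz
    rw [← heq] at this
    exact this
  exact closure_minimal h1 (c i.castSucc).3 (hdense _ hy)

/-! ### Zero loci in affine space -/

section Affine

open MvPolynomial

variable {k : Type u} [Field k] {n : ℕ}

/-- The chain consists of the kernels of the retractions `φ i` killing the first `i` variables. The
identity `φ (i + 1) ∘ φ i = φ (i + 1)` gives the inclusions, and `X i` shows that they are strict.
-/
theorem le_height_ker_eval_zero :
    (n : ℕ∞) ≤ (RingHom.ker (eval (0 : Fin n → k))).height := by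
  classical
  let φ : ℕ → MvPolynomial (Fin n) k →ₐ[k] MvPolynomial (Fin n) k := fun i =>
    aeval fun j => if (j : ℕ) < i then 0 else X j
  let P : ℕ → PrimeSpectrum (MvPolynomial (Fin n) k) := fun i =>
    ⟨RingHom.ker (φ i), RingHom.ker_isPrime _⟩
  have hcomp : ∀ i, (φ (i + 1)).comp (φ i) = φ (i + 1) := by
    intro i
    ext j : 1
    simp only [φ, AlgHom.comp_apply, aeval_X]
    by_cases h1 : (j : ℕ) < i
    · rw [if_pos h1, if_pos (h1.trans i.lt_succ_self), map_zero]
    · rw [if_neg h1, aeval_X]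
  have hlt : ∀ i : Fin n, P i < P (i + 1) := by
    intro i
    refine lt_of_le_of_ne (fun p hp => ?_) fun h => ?_
    · change φ _ p = 0
      have hp : φ _ p = 0 := hp
      rw [← hcomp, AlgHom.comp_apply, hp, map_zero]
    · have h1 : (X i : MvPolynomial (Fin n) k) ∈ (P (i + 1)).asIdeal := by
        change φ _ _ = 0
        simp [φ]
      rw [← h] at h1
      have h1 : φ _ _ = 0 := h1
      simp [φ] at h1
  let c : LTSeries (PrimeSpectrum (MvPolynomial (Fin n) k)) :=
    ⟨n, fun i => P i, fun i => by simpa using hlt i⟩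
  have hlast : c.last.asIdeal = RingHom.ker (eval (0 : Fin n → k)) := by
    change RingHom.ker (φ ((Fin.last n : Fin (n + 1)) : ℕ)) = _
    have : φ ((Fin.last n : Fin (n + 1)) : ℕ)
        = (Algebra.ofId k (MvPolynomial (Fin n) k)).comp (aeval (0 : Fin n → k)) := by
      ext j : 1
      simp [φ]
    ext p
    rw [this, RingHom.mem_ker, RingHom.mem_ker, AlgHom.comp_apply, Algebra.ofId_apply,
      FaithfulSMul.algebraMap_eq_zero_iff, ← coe_aeval_eq_eval]
    rfl
  rw [← hlast, PrimeSpectrum.height_eq_orderHeight]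
  exact Order.length_le_height_last (p := c)

variable {X : Type*} [TopologicalSpace X]

/-- A map to an affine space such that the topology is the pullback of the Zariski topology. -/
def IsAffineChart (e : X → Fin n → k) : Prop :=
  ∀ Z : Set X, IsClosed Z ↔
    ∃ S : Set (MvPolynomial (Fin n) k), Z = {x | ∀ p ∈ S, eval (e x) p = 0}

/-- The chart induces the topology of `X` from the spectrum of `k[x]/(F)`, whose dimension is at
most `n - 1` because `F` is not a zero divisor. -/
theorem topologicalKrullDim_add_one_le {e : X → Fin n → k} (he : IsAffineChart e)
    {F : MvPolynomial (Fin n) k} (hF0 : F ≠ 0) (hF : ∀ x, eval (e x) F = 0) :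
    topologicalKrullDim X + 1 ≤ n := by
  have hle : ∀ x, ∀ p ∈ Ideal.span {F}, eval (e x) p = 0 := by
    intro x p hp
    obtain ⟨q, rfl⟩ := Ideal.mem_span_singleton.1 hp
    simp [hF]
  let f : X → PrimeSpectrum (MvPolynomial (Fin n) k ⧸ Ideal.span {F}) := fun x =>
    ⟨RingHom.ker (Ideal.Quotient.lift _ (eval (e x)) (hle x)), RingHom.ker_isPrime _⟩
  have hf : ∀ x p, Ideal.Quotient.mk _ p ∈ (f x).asIdeal ↔ eval (e x) p = 0 := by
    intro x p
    simp [f, RingHom.mem_ker]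
  have hind : IsInducing f := by
    refine ⟨TopologicalSpace.ext_isClosed fun Z => ?_⟩
    rw [he, isClosed_induced_iff]
    constructor
    · rintro ⟨S, rfl⟩
      refine ⟨PrimeSpectrum.zeroLocus (Ideal.Quotient.mk _ '' S),
        PrimeSpectrum.isClosed_zeroLocus _, ?_⟩
      ext x
      simp only [Set.mem_preimage, PrimeSpectrum.mem_zeroLocus, Set.image_subset_iff]
      exact forall₂_congr fun p _ => hf x p
    · rintro ⟨T, hT, rfl⟩
      obtain ⟨S, rfl⟩ := (PrimeSpectrum.isClosed_iff_zeroLocus _).1 hT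
      refine ⟨Ideal.Quotient.mk _ ⁻¹' S, ?_⟩
      ext x
      simp only [Set.mem_preimage, PrimeSpectrum.mem_zeroLocus, Set.subset_def]
      constructor
      · intro h p hp
        exact (hf x p).1 (h _ hp)
      · intro h q hq
        obtain ⟨p, rfl⟩ := Ideal.Quotient.mk_surjective q
        exact (hf x p).2 (h p hq)
  calc topologicalKrullDim X + 1
      ≤ ringKrullDim (MvPolynomial (Fin n) k ⧸ Ideal.span {F}) + 1 := by
        rw [← PrimeSpectrum.topologicalKrullDim_eq_ringKrullDim]
        gcongr
        exact hind.topologicalKrullDim_le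
    _ ≤ ringKrullDim (MvPolynomial (Fin n) k) :=
        ringKrullDim_quotient_succ_le_of_nonZeroDivisor (mem_nonZeroDivisors_of_ne_zero hF0)
    _ = n := by
        rw [MvPolynomial.ringKrullDim_of_isNoetherianRing, ringKrullDim_eq_zero_of_field]
        simp

/-- Every prime between `(F)` and the ideal `m` of the origin gives a closed subset of `X`. Since
`d` does not vanish at the origin, it lies in none of these primes, so by the Nullstellensatz the
points with `d ≠ 0`, all of which come from `X`, still determine the prime. These subsets are thus
irreducible and distinct, and the height of `m` drops by at most one modulo `F`. -/
theorem le_topologicalKrullDim_add_one [IsAlgClosed k] {e : X → Fin n → k} (he : IsAffineChart e)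
    {F d : MvPolynomial (Fin n) k} (hFd : ∀ s, eval s F = 0 → eval s d ≠ 0 → ∃ x, e x = s)
    (hF0 : eval 0 F = 0) (hd0 : eval 0 d ≠ 0) :
    (n : WithBot ℕ∞) ≤ topologicalKrullDim X + 1 := by
  classical
  set m : Ideal (MvPolynomial (Fin n) k) := RingHom.ker (eval 0)
  have hm : m.IsPrime := RingHom.ker_isPrime _
  set I : Ideal (MvPolynomial (Fin n) k) := Ideal.span {F}
  have hIm : I ≤ m := (Ideal.span_singleton_le_iff_mem _).2 hF0
  let mk := Ideal.Quotient.mk I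
  have hmI : (m.map mk).IsPrime := Ideal.isPrime_map_quotientMk_of_isPrime hIm
  let M : PrimeSpectrum (MvPolynomial (Fin n) k ⧸ I) := ⟨m.map mk, hmI⟩
  let Q : Set.Iic M → Ideal (MvPolynomial (Fin n) k) := fun p => p.1.asIdeal.comap mk
  have hQp : ∀ p, (Q p).IsPrime := fun p => Ideal.comap_isPrime _ _
  have hQm : ∀ p, Q p ≤ m := by
    intro p
    refine (Ideal.comap_mono (show p.1.asIdeal ≤ m.map mk from p.2)).trans ?_
    rw [Ideal.comap_map_of_surjective' _ Ideal.Quotient.mk_surjective, Ideal.mk_ker,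
      sup_eq_left.2 hIm]
  have hFQ : ∀ p, F ∈ Q p := by
    intro p
    change mk F ∈ p.1.asIdeal
    rw [Ideal.Quotient.eq_zero_iff_mem.2 (Ideal.mem_span_singleton_self F)]
    exact zero_mem _
  -- a polynomial outside of a prime is nonzero somewhere
  have hex : ∀ p, ∀ f ∉ Q p, ∃ x : X, (∀ q ∈ Q p, eval (e x) q = 0) ∧ eval (e x) f ≠ 0 := by
    intro p f hf
    have hd : d ∉ Q p := fun h => hd0 (hQm p h)
    have hfd : f * d ∉ Q p := fun h => ((hQp p).mem_or_mem h).elim hf hd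
    have := hQp p
    rw [← MvPolynomial.IsPrime.vanishingIdeal_zeroLocus (K := k) (Q p)] at hfd
    simp only [mem_vanishingIdeal_iff, not_forall, mem_zeroLocus_iff] at hfd
    obtain ⟨s, hs, hs'⟩ := hfd
    have hs0 : eval s f * eval s d ≠ 0 := by simpa [coe_aeval_eq_eval] using hs'
    obtain ⟨x, rfl⟩ := hFd s (by simpa using hs F (hFQ p)) (right_ne_zero_of_mul hs0)
    exact ⟨x, fun q hq => by simpa using hs q hq, left_ne_zero_of_mul hs0⟩
  let Z : Set.Iic M → IrreducibleCloseds X := fun p =>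
    { carrier := {x | ∀ q ∈ Q p, eval (e x) q = 0}
      isClosed' := (he _).2 ⟨Q p, rfl⟩
      isIrreducible' := by
        constructor
        · obtain ⟨x, hx, -⟩ := hex p 1 ((Ideal.ne_top_iff_one _).1 (hQp p).ne_top)
          exact ⟨x, hx⟩
        · rintro U V hU hV ⟨x, hx, hxU⟩ ⟨y, hy, hyV⟩
          obtain ⟨S, hS⟩ := (he _).1 hU.isClosed_compl
          obtain ⟨T, hT⟩ := (he _).1 hV.isClosed_compl
          have hxS : x ∉ Uᶜ := fun h => h hxU
          have hyT : y ∉ Vᶜ := fun h => h hyV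
          simp only [hS, hT, Set.mem_ofPred_eq, not_forall] at hxS hyT
          obtain ⟨f, hfS, hf⟩ := hxS
          obtain ⟨g, hgT, hg⟩ := hyT
          obtain ⟨z, hz, hz'⟩ := hex p (f * g) fun h =>
            ((hQp p).mem_or_mem h).elim (fun h => hf (hx _ h)) fun h => hg (hy _ h)
          rw [map_mul] at hz'
          refine ⟨z, hz, ?_, ?_⟩
          · by_contra hzU
            have : z ∈ Uᶜ := hzU
            rw [hS] at this
            exact left_ne_zero_of_mul hz' (this f hfS)
          · by_contra hzV
            have : z ∈ Vᶜ := hzV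
            rw [hT] at this
            exact right_ne_zero_of_mul hz' (this g hgT) }
  have hanti : StrictMono fun p : (Set.Iic M)ᵒᵈ => Z (OrderDual.ofDual p) := by
    intro p q hpq
    have hlt : OrderDual.ofDual q < OrderDual.ofDual p := hpq
    have hQ : Q (OrderDual.ofDual q) ≤ Q (OrderDual.ofDual p) := Ideal.comap_mono hlt.le
    have hnot : ¬ Q (OrderDual.ofDual p) ≤ Q (OrderDual.ofDual q) := by
      intro h
      refine hlt.not_ge (show (OrderDual.ofDual p).1.asIdeal ≤ (OrderDual.ofDual q).1.asIdeal from ?_)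
      intro a ha
      obtain ⟨b, rfl⟩ := Ideal.Quotient.mk_surjective a
      exact h ha
    refine lt_of_le_not_ge (fun x hx g hg => hx g (hQ hg)) fun hle => ?_
    obtain ⟨f, hfp, hfq⟩ := SetLike.not_le_iff_exists.1 hnot
    obtain ⟨x, hx, hxf⟩ := hex _ f hfq
    exact hxf (hle (show x ∈ Z (OrderDual.ofDual q) from hx) f hfp)
  have h1 : Order.krullDim (Set.Iic M) ≤ topologicalKrullDim X := by
    rw [← Order.krullDim_orderDual]
    exact Order.krullDim_le_of_strictMono _ hanti
  rw [← Order.height_eq_krullDim_Iic] at h1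
  have h2 : (n : ℕ∞) ≤ Order.height M + 1 := by
    refine le_height_ker_eval_zero.trans ((Ideal.height_le_height_add_one_of_mem
      (r := F) (show F ∈ m from hF0)).trans ?_)
    rw [← PrimeSpectrum.height_eq_orderHeight]
  calc (n : WithBot ℕ∞) = ((n : ℕ∞) : WithBot ℕ∞) := rfl
    _ ≤ ((Order.height M + 1 : ℕ∞) : WithBot ℕ∞) := by exact_mod_cast h2
    _ ≤ _ := by
      rw [WithBot.coe_add]
      exact add_le_add_left h1 1

end Affine

end DerivedSemicont

namespace DerivedSemicont

open Module

/-! ### Maps with regular components -/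

section Regular

variable {k : Type u} [Field k] {X : Type*} {V V' V'' : Type*}
  [AddCommGroup V] [Module k V] [AddCommGroup V'] [Module k V'] [AddCommGroup V''] [Module k V'']

/-- Maps to a vector space whose compositions with all linear forms belong to a given algebra of
functions. -/
def IsRegMap (𝒪 : Subalgebra k (X → k)) (f : X → V) : Prop :=
  ∀ φ : Dual k V, (fun x => φ (f x)) ∈ 𝒪

namespace IsRegMap

variable {𝒪 : Subalgebra k (X → k)}

theorem const (v : V) : IsRegMap 𝒪 fun _ => v := fun φ => 𝒪.algebraMap_mem (φ v)

theorem comp_linear {f : X → V} (hf : IsRegMap 𝒪 f) (L : V →ₗ[k] V') :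
    IsRegMap 𝒪 fun x => L (f x) := fun φ => hf (φ ∘ₗ L)

theorem add {f g : X → V} (hf : IsRegMap 𝒪 f) (hg : IsRegMap 𝒪 g) :
    IsRegMap 𝒪 fun x => f x + g x := fun φ => by
  simp only [map_add]
  exact 𝒪.add_mem (hf φ) (hg φ)

theorem sub {f g : X → V} (hf : IsRegMap 𝒪 f) (hg : IsRegMap 𝒪 g) :
    IsRegMap 𝒪 fun x => f x - g x := fun φ => by
  simp only [map_sub]
  exact 𝒪.sub_mem (hf φ) (hg φ)

theorem smul {a : X → k} {f : X → V} (ha : a ∈ 𝒪) (hf : IsRegMap 𝒪 f) :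
    IsRegMap 𝒪 fun x => a x • f x := fun φ => by
  simp only [map_smul, smul_eq_mul]
  exact 𝒪.mul_mem ha (hf φ)

theorem sum {ι : Type*} {s : Finset ι} {f : ι → X → V} (hf : ∀ i ∈ s, IsRegMap 𝒪 (f i)) :
    IsRegMap 𝒪 fun x => ∑ i ∈ s, f i x := fun φ => by
  have := 𝒪.sum_mem fun i hi => hf i hi φ
  convert! this using 1
  ext x
  simp

theorem bilin [Module.Finite k V] {f : X → V} {g : X → V'} (hf : IsRegMap 𝒪 f)
    (hg : IsRegMap 𝒪 g) (B : V →ₗ[k] V' →ₗ[k] V'') : IsRegMap 𝒪 fun x => B (f x) (g x) := by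
  let b := Module.finBasis k V
  have h : (fun x => B (f x) (g x)) = fun x => ∑ i, b.coord i (f x) • B (b i) (g x) := by
    funext x
    conv_lhs => rw [← b.sum_repr (f x)]
    simp only [map_sum, map_smul, LinearMap.sum_apply, LinearMap.smul_apply, Basis.coord_apply]
  rw [h]
  exact sum fun i _ => smul (hf _) (hg.comp_linear _)

theorem apply [Module.Finite k V] [Module.Finite k V'] {f : X → V →ₗ[k] V'} {g : X → V}
    (hf : IsRegMap 𝒪 f) (hg : IsRegMap 𝒪 g) : IsRegMap 𝒪 fun x => f x (g x) :=
  hf.bilin hg LinearMap.id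

theorem matrix_det {n : Type*} [Fintype n] [DecidableEq n] {M : X → Matrix n n k}
    (hM : ∀ i j, (fun x => M x i j) ∈ 𝒪) : (fun x => (M x).det) ∈ 𝒪 := by
  have h : (fun x => (M x).det) =
      ∑ σ : Equiv.Perm n, (algebraMap k (X → k) ((σ.sign : ℤ) : k)) *
        ∏ i, (fun x => M x (σ i) i) := by
    ext x
    simp [Matrix.det_apply', Finset.sum_apply, Finset.prod_apply]
  rw [h]
  exact 𝒪.sum_mem fun σ _ => 𝒪.mul_mem (𝒪.algebraMap_mem _) (𝒪.prod_mem fun i _ => hM _ _)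

theorem matrix_adjugate {n : Type*} [Fintype n] [DecidableEq n] {M : X → Matrix n n k}
    (hM : ∀ i j, (fun x => M x i j) ∈ 𝒪) (i j : n) : (fun x => (M x).adjugate i j) ∈ 𝒪 := by
  simp only [Matrix.adjugate_apply]
  refine matrix_det fun a b => ?_
  by_cases ha : a = j
  · subst ha
    simp only [Matrix.updateRow_self]
    exact 𝒪.algebraMap_mem (Pi.single (M := fun _ => k) i 1 b)
  · simpa [Matrix.updateRow_ne ha] using hM a b

theorem toMatrix_mem {n : Type*} [Fintype n] [DecidableEq n] {f : X → V →ₗ[k] V}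
    (hf : IsRegMap 𝒪 f) (b : Basis n k V) (i j : n) :
    (fun x => LinearMap.toMatrix b b (f x) i j) ∈ 𝒪 := by
  have := hf (b.coord i ∘ₗ LinearMap.applyₗ (b j))
  simpa [LinearMap.toMatrix_apply] using this

theorem det [Module.Finite k V] {f : X → V →ₗ[k] V} (hf : IsRegMap 𝒪 f) :
    (fun x => LinearMap.det (f x)) ∈ 𝒪 := by
  let b := Module.finBasis k V
  simp only [← LinearMap.det_toMatrix b]
  exact matrix_det (hf.toMatrix_mem b)

/-- Cramer's rule. -/
theorem exists_solution [Module.Finite k V] {f : X → V →ₗ[k] V} {v : X → V}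
    (hf : IsRegMap 𝒪 f) (hv : IsRegMap 𝒪 v) :
    ∃ g : X → V, IsRegMap 𝒪 g ∧ ∀ x, LinearMap.det (f x) ≠ 0 → ∀ z,
      f x z = v x ↔ z = (LinearMap.det (f x))⁻¹ • g x := by
  let b := Module.finBasis k V
  let a : X → V →ₗ[k] V := fun x => Matrix.toLin b b (LinearMap.toMatrix b b (f x)).adjugate
  have ha : IsRegMap 𝒪 a := by
    have h : a = fun x => ∑ i, ∑ j, (LinearMap.toMatrix b b (f x)).adjugate i j •
        Matrix.toLin b b (Matrix.single i j 1) := by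
      funext x
      simp only [a]
      conv_lhs => rw [Matrix.matrix_eq_sum_single (LinearMap.toMatrix b b (f x)).adjugate]
      simp only [map_sum]
      refine Finset.sum_congr rfl fun i _ => Finset.sum_congr rfl fun j _ => ?_
      rw [← map_smul, Matrix.smul_single, smul_eq_mul, mul_one]
    rw [h]
    exact sum fun i _ => sum fun j _ =>
      smul (matrix_adjugate (hf.toMatrix_mem b) i j) (const _)
  have hfa : ∀ x, f x ∘ₗ a x = LinearMap.det (f x) • LinearMap.id := by
    intro x
    apply (LinearMap.toMatrix b b).injective
    rw [LinearMap.toMatrix_comp b b b, LinearMap.toMatrix_toLin, Matrix.mul_adjugate,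
      LinearMap.det_toMatrix, map_smul, LinearMap.toMatrix_id]
  have haf : ∀ x, a x ∘ₗ f x = LinearMap.det (f x) • LinearMap.id := by
    intro x
    apply (LinearMap.toMatrix b b).injective
    rw [LinearMap.toMatrix_comp b b b, LinearMap.toMatrix_toLin, Matrix.adjugate_mul,
      LinearMap.det_toMatrix, map_smul, LinearMap.toMatrix_id]
  refine ⟨fun x => a x (v x), ha.apply hv, fun x hx z => ⟨fun h => ?_, ?_⟩⟩
  · have h1 := LinearMap.congr_fun (haf x) z
    simp only [LinearMap.comp_apply, LinearMap.smul_apply, LinearMap.id_apply] at h1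
    change z = _ • a x (v x)
    rw [← h, h1, smul_smul, inv_mul_cancel₀ hx, one_smul]
  · rintro rfl
    have h1 := LinearMap.congr_fun (hfa x) (v x)
    simp only [LinearMap.comp_apply, LinearMap.smul_apply, LinearMap.id_apply] at h1
    rw [map_smul, h1, smul_smul, inv_mul_cancel₀ hx, one_smul]

end IsRegMap

/-- The algebra of polynomial functions on a vector space. -/
noncomputable def polyFun (k : Type u) [Field k] (V : Type*) [AddCommGroup V] [Module k V] :
    Subalgebra k (V → k) :=
  (AlgHom.pi fun x : V =>
    MvPolynomial.aeval fun φ : Dual k V => φ x).range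

theorem mem_polyFun {q : V → k} :
    q ∈ polyFun k V ↔ ∃ p : MvPolynomial (Dual k V) k, ∀ x, polyEval p x = q x := by
  simp [polyFun, funext_iff, polyEval]

theorem isRegMap_id : IsRegMap (polyFun k V) (id : V → V) := fun φ =>
  mem_polyFun.2 ⟨MvPolynomial.X φ, fun x => by simp [polyEval]⟩

/-- The pullback of a polynomial function by a rational map, with the denominators cleared. -/
theorem IsRegMap.exists_pullback {𝒪 : Subalgebra k (X → k)} {F : X → V} (hF : IsRegMap 𝒪 F)
    {d : X → k} (hd : d ∈ 𝒪) {q : V → k} (hq : q ∈ polyFun k V) :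
    ∃ Q ∈ 𝒪, ∀ x, d x ≠ 0 → (Q x = 0 ↔ q ((d x)⁻¹ • F x) = 0) := by
  -- Some power of `d` clears all denominators. Leaving the exponent free lets the induction pass
  -- through sums by cross-multiplication.
  suffices h : ∃ (N : ℕ), ∃ Q ∈ 𝒪, ∀ x, d x ≠ 0 → Q x = d x ^ N * q ((d x)⁻¹ • F x) by
    obtain ⟨N, Q, hQ, h⟩ := h
    exact ⟨Q, hQ, fun x hx => by simp [h x hx, hx]⟩
  obtain ⟨p, hp⟩ := mem_polyFun.1 hq
  simp only [← hp]
  clear hp hq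
  induction p using MvPolynomial.induction_on with
  | C a => exact ⟨0, _, 𝒪.algebraMap_mem a, fun x _ => by simp [polyEval]⟩
  | add p p' h h' =>
    obtain ⟨N, Q, hQ, h⟩ := h
    obtain ⟨N', Q', hQ', h'⟩ := h'
    refine ⟨N + N', d ^ N' * Q + d ^ N * Q',
      𝒪.add_mem (𝒪.mul_mem (𝒪.pow_mem hd _) hQ) (𝒪.mul_mem (𝒪.pow_mem hd _) hQ'), fun x hx => ?_⟩
    simp only [Pi.add_apply, Pi.mul_apply, Pi.pow_apply, h x hx, h' x hx, polyEval, map_add]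
    ring
  | mul_X p φ h =>
    obtain ⟨N, Q, hQ, h⟩ := h
    refine ⟨N + 1, Q * fun x => φ (F x), 𝒪.mul_mem hQ (hF φ), fun x hx => ?_⟩
    simp only [Pi.mul_apply, h x hx, polyEval, map_mul, MvPolynomial.eval_X, map_smul, smul_eq_mul]
    generalize MvPolynomial.eval _ p = c
    rw [pow_succ]
    field_simp

/-- The closed sets of the topology are the pullbacks of the zero loci of the functions of `𝒪`. -/
def IsChart {N : Type*} [TopologicalSpace N] (𝒪 : Subalgebra k (X → k)) (e : N → X) : Prop :=
  ∀ Z : Set N, IsClosed Z ↔ ∃ S ⊆ (𝒪 : Set (X → k)), Z = {y | ∀ q ∈ S, q (e y) = 0}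

theorem IsChart.transfer {N : Type*} [TopologicalSpace N] {κ : N → V}
    (hκ : IsChart (polyFun k V) κ) {e : N → V'} {F : V' → V} {d : V' → k}
    (hF : IsRegMap (polyFun k V') F) (hd : d ∈ polyFun k V') (hde : ∀ y, d (e y) ≠ 0)
    (hFe : ∀ y, κ y = (d (e y))⁻¹ • F (e y)) {E : V → V'} {D : V → k}
    (hE : IsRegMap (polyFun k V) E) (hD : D ∈ polyFun k V) (hDκ : ∀ y, D (κ y) ≠ 0)
    (hEκ : ∀ y, e y = (D (κ y))⁻¹ • E (κ y)) :
    IsChart (polyFun k V') e := by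
  intro Z
  rw [hκ Z]
  constructor
  · rintro ⟨S, hS, rfl⟩
    choose! Q hQ hQ' using fun q (hq : q ∈ polyFun k V) => hF.exists_pullback hd hq
    refine ⟨Q '' S, by rintro _ ⟨q, hq, rfl⟩; exact hQ q (hS hq), ?_⟩
    ext y
    simp only [Set.mem_ofPred_eq, Set.forall_mem_image]
    refine forall₂_congr fun q hq => ?_
    rw [hQ' q (hS hq) _ (hde y), ← hFe]
  · rintro ⟨S, hS, rfl⟩
    choose! Q hQ hQ' using fun q (hq : q ∈ polyFun k V') => hE.exists_pullback hD hq
    refine ⟨Q '' S, by rintro _ ⟨q, hq, rfl⟩; exact hQ q (hS hq), ?_⟩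
    ext y
    simp only [Set.mem_ofPred_eq, Set.forall_mem_image]
    refine forall₂_congr fun q hq => ?_
    rw [hQ' q (hS hq) _ (hDκ y), ← hEκ]

/-- Bridges polynomials with one variable per linear form and polynomials with one variable per
coordinate: a form `φ` is replaced by `∑ φ(e_i) X_i`. -/
theorem mem_polyFun_pi {n : ℕ} {q : (Fin n → k) → k} :
    q ∈ polyFun k (Fin n → k) ↔
      ∃ p : MvPolynomial (Fin n) k, ∀ s, MvPolynomial.eval s p = q s := by
  constructor
  · intro hq
    obtain ⟨p, hp⟩ := mem_polyFun.1 hq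
    refine ⟨MvPolynomial.aeval (fun φ : Dual k (Fin n → k) =>
      ∑ i, MvPolynomial.C (φ (Pi.single i 1)) * MvPolynomial.X i) p, fun s => ?_⟩
    rw [← hp, polyEval, ← MvPolynomial.coe_aeval_eq_eval, ← MvPolynomial.coe_aeval_eq_eval]
    change ((MvPolynomial.aeval s).comp (MvPolynomial.aeval _)) p = MvPolynomial.aeval _ p
    congr 1
    ext φ
    simp only [AlgHom.comp_apply, MvPolynomial.aeval_X, map_sum, map_mul, MvPolynomial.aeval_C]
    conv_rhs => rw [← LinearMap.sum_single_apply (fun _ : Fin n => k) s]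
    rw [map_sum]
    refine Finset.sum_congr rfl fun i _ => ?_
    have : (Pi.single i (s i) : Fin n → k) = s i • Pi.single i 1 := by
      rw [← Pi.single_smul, smul_eq_mul, mul_one]
    simp [this, mul_comm]
  · rintro ⟨p, hp⟩
    refine mem_polyFun.2 ⟨MvPolynomial.rename (fun i => LinearMap.proj i) p, fun s => ?_⟩
    rw [polyEval, MvPolynomial.eval_rename, ← hp]
    rfl

theorem IsChart.isAffineChart {N : Type*} [TopologicalSpace N] {n : ℕ} {e : N → Fin n → k}
    (he : IsChart (polyFun k (Fin n → k)) e) : IsAffineChart e := by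
  intro Z
  rw [he Z]
  constructor
  · rintro ⟨S, hS, rfl⟩
    refine ⟨{p | (fun s => MvPolynomial.eval s p) ∈ S}, ?_⟩
    ext y
    simp only [Set.mem_ofPred_eq]
    refine ⟨fun h p hp => h _ hp, fun h q hq => ?_⟩
    obtain ⟨p, hp⟩ := mem_polyFun_pi.1 (hS hq)
    rw [← hp]
    refine h p ?_
    convert hq
    exact hp _
  · rintro ⟨S, rfl⟩
    refine ⟨(fun p s => MvPolynomial.eval s p) '' S, ?_, ?_⟩
    · rintro _ ⟨p, -, rfl⟩
      exact mem_polyFun_pi.2 ⟨p, fun _ => rfl⟩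
    · ext y
      simp

end Regular

/-! ### Affine charts of the projective space -/

section Projective

open MvPolynomial LinearAlgebra.Projectivization

variable {k : Type u} [Field k] {V : Type w} [AddCommGroup V] [Module k V]

theorem polyEval_smul {p : MvPolynomial (Dual k V) k} {d : ℕ} (hp : p.IsHomogeneous d) (c : k)
    (x : V) : polyEval p (c • x) = c ^ d * polyEval p x := by
  unfold polyEval
  rw [← eval_smul_of_isHomogeneous hp]
  congr 2
  funext φ
  simp

theorem mem_projZeroLocus {S : Set (MvPolynomial (Dual k V) k)}
    (hS : ∀ p ∈ S, ∃ d : ℕ, p.IsHomogeneous d) {x : ℙ k V} {h : V} (hx : h ∈ x.submodule)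
    (h0 : h ≠ 0) : x ∈ projZeroLocus S ↔ ∀ p ∈ S, polyEval p h = 0 := by
  refine forall₂_congr fun p hp => ⟨fun H => H h hx h0, fun H h' hx' _ => ?_⟩
  obtain ⟨d, hd⟩ := hS p hp
  obtain ⟨c, rfl⟩ : ∃ c : k, c • h = h' := by
    rw [Projectivization.submodule_eq, Submodule.mem_span_singleton] at hx hx'
    obtain ⟨a, rfl⟩ := hx
    obtain ⟨b, rfl⟩ := hx'
    have ha : a ≠ 0 := by
      rintro rfl
      exact h0 (zero_smul _ _)
    exact ⟨b * a⁻¹, by rw [smul_smul, mul_assoc, inv_mul_cancel₀ ha, mul_one]⟩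
  rw [polyEval_smul hd, H, mul_zero]

theorem isClosed_projective {Z : Set (ℙ k V)} : IsClosed Z ↔
    ∃ S : Set (MvPolynomial (Dual k V) k), (∀ p ∈ S, ∃ d : ℕ, p.IsHomogeneous d) ∧
      Z = {x | ∀ p ∈ S, polyEval p x.rep = 0} := by
  have hZ : IsClosed Z ↔ ∃ S : Set (MvPolynomial (Dual k V) k),
      (∀ p ∈ S, ∃ d : ℕ, p.IsHomogeneous d) ∧ Zᶜᶜ = projZeroLocus S := isOpen_compl_iff.symm
  rw [hZ, compl_compl]
  refine exists_congr fun S => and_congr_right fun hS => ?_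
  have : projZeroLocus S = {x | ∀ p ∈ S, polyEval p x.rep = 0} := by
    ext x
    refine mem_projZeroLocus hS ?_ x.rep_nonzero
    rw [Projectivization.submodule_eq]
    exact Submodule.mem_span_singleton_self _
  rw [this]

/-- The homogenization of a polynomial with respect to a linear form. -/
theorem exists_homogenization (l : Dual k V) (q : MvPolynomial (Dual k V) k) :
    ∃ N : ℕ, ∃ p : MvPolynomial (Dual k V) k, p.IsHomogeneous N ∧
      ∀ v, l v ≠ 0 → polyEval p v = l v ^ N * polyEval q ((l v)⁻¹ • v) := by
  refine ⟨q.totalDegree, ∑ i ∈ Finset.range (q.totalDegree + 1),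
    X l ^ (q.totalDegree - i) * homogeneousComponent i q, ?_, fun v hv => ?_⟩
  · refine IsHomogeneous.sum _ _ _ fun i hi => ?_
    have h := (isHomogeneous_X_pow (R := k) l (q.totalDegree - i)).mul
      (homogeneousComponent_isHomogeneous i q)
    rwa [Nat.sub_add_cancel (Nat.lt_succ_iff.1 (Finset.mem_range.1 hi))] at h
  · have hq : polyEval q ((l v)⁻¹ • v) = ∑ i ∈ Finset.range (q.totalDegree + 1),
        polyEval (homogeneousComponent i q) ((l v)⁻¹ • v) := by
      conv_lhs => rw [← sum_homogeneousComponent q]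
      simp [polyEval]
    rw [hq, Finset.mul_sum]
    simp only [polyEval, map_sum, map_mul, map_pow, eval_X]
    refine Finset.sum_congr rfl fun i hi => ?_
    have h := polyEval_smul (homogeneousComponent_isHomogeneous i q) (l v)⁻¹ v
    simp only [polyEval] at h
    rw [h, ← mul_assoc]
    congr 1
    rw [inv_pow, ← div_eq_mul_inv, pow_sub₀ _ hv (Nat.lt_succ_iff.1 (Finset.mem_range.1 hi)),
      div_eq_mul_inv]

/-- The representative of a line on which a linear form has the value `1`. -/
noncomputable def affineRep (l : Dual k V) (x : ℙ k V) : V := (l x.rep)⁻¹ • x.rep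

theorem affineRep_eq {l : Dual k V} {h : V} (h0 : h ≠ 0) (hl : l h = 1) :
    affineRep l (Projectivization.mk k h h0) = h := by
  obtain ⟨a, ha⟩ := Projectivization.exists_smul_eq_mk_rep k h h0
  rw [affineRep, ← ha, Units.smul_def, map_smul, hl, smul_smul]
  simp

/-- Homogeneous equations may be tested on the normalized representative. Conversely, homogenizing
with respect to `l` changes values only by powers of `l`, which is nonzero here. -/
theorem isChart_affineRep {N : Type*} [TopologicalSpace N] {j : N → ℙ k V}
    (hj : Topology.IsInducing j) (l : Dual k V) (hl : ∀ y, l (j y).rep ≠ 0) :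
    IsChart (polyFun k V) fun y => affineRep l (j y) := by
  intro Z
  rw [hj.isClosed_iff]
  constructor
  · rintro ⟨T, hT, rfl⟩
    obtain ⟨S, hS, rfl⟩ := isClosed_projective.1 hT
    refine ⟨polyEval '' S, ?_, ?_⟩
    · rintro _ ⟨p, -, rfl⟩
      exact mem_polyFun.2 ⟨p, fun _ => rfl⟩
    · ext y
      simp only [Set.mem_preimage, Set.mem_ofPred_eq, Set.forall_mem_image]
      refine forall₂_congr fun p hp => ?_
      obtain ⟨d, hd⟩ := hS p hp
      rw [affineRep, polyEval_smul hd]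
      simp [hl y]
  · rintro ⟨S, hS, rfl⟩
    choose! q hq using fun f (hf : f ∈ polyFun k V) => mem_polyFun.1 hf
    choose m p hp hp' using exists_homogenization l
    refine ⟨{x | ∀ f ∈ (p ∘ q) '' S, polyEval f x.rep = 0},
      isClosed_projective.2 ⟨_, ?_, rfl⟩, ?_⟩
    · rintro _ ⟨f, -, rfl⟩
      exact ⟨_, hp _⟩
    · ext y
      simp only [Set.mem_preimage, Set.mem_ofPred_eq, Set.forall_mem_image]
      refine forall₂_congr fun f hf => ?_
      rw [Function.comp_apply, hp' _ _ (hl y), ← hq f (hS hf), affineRep]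
      simp [hl y]

theorem isOpen_affineRep_ne_zero (l : Dual k V) {q : V → k} (hq : q ∈ polyFun k V) :
    IsOpen {x : ℙ k V | l x.rep ≠ 0 ∧ q (affineRep l x) ≠ 0} := by
  obtain ⟨q, hq⟩ := mem_polyFun.1 hq
  obtain ⟨m, p, hp, hp'⟩ := exists_homogenization l q
  rw [← isClosed_compl_iff, isClosed_projective]
  -- The factor `X l` puts the hyperplane `l = 0`, where `p` carries no information on `q`, into the
  -- complement.
  refine ⟨{X l * p}, ?_, ?_⟩
  · rintro _ rfl
    exact ⟨_, (isHomogeneous_X k l).mul hp⟩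
  · ext x
    by_cases hx : l x.rep = 0
    · simp [hx, polyEval]
    · have := hp' _ hx
      rw [polyEval] at this
      simp [hx, polyEval, this, ← hq, affineRep]

end Projective

end DerivedSemicont

namespace DerivedSemicont

open Module

/-! ### Conjugation in bimodules -/

section Linear

variable {k : Type u} [Field k] {W H : Type*} [AddCommGroup W] [Module k W]
  [AddCommGroup H] [Module k H]

/-- A coordinate-free minor of size `r`. With `ι` and `π` fixed, a determinant then tests the rank
of nearby maps. -/
theorem exists_comp_comp_eq_id (T : W →ₗ[k] H) {r : ℕ} (hr : r ≤ finrank k (LinearMap.range T)) :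
    ∃ (ι : (Fin r → k) →ₗ[k] W) (π : H →ₗ[k] (Fin r → k)), π ∘ₗ T ∘ₗ ι = LinearMap.id := by
  obtain ⟨f, hf⟩ : ∃ f : (Fin r → k) →ₗ[k] LinearMap.range T, Function.Injective f := by
    obtain ⟨v, hv⟩ := exists_linearIndependent_of_le_finrank hr
    exact ⟨_, linearIndependent_iff_injective_fintypeLinearCombination.1 hv⟩
  obtain ⟨ι, hι⟩ := Module.projective_lifting_property T.rangeRestrict f T.surjective_rangeRestrict
  obtain ⟨π, hπ⟩ := LinearMap.exists_leftInverse_of_injective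
    ((LinearMap.range T).subtype ∘ₗ f) (LinearMap.ker_eq_bot.2
      ((LinearMap.range T).injective_subtype.comp hf))
  refine ⟨ι, π, ?_⟩
  rw [← hπ, ← hι]
  rfl

theorem le_finrank_range_of_det_ne_zero [Module.Finite k H] {T : W →ₗ[k] H} {r : ℕ} {ι : (Fin r → k) →ₗ[k] W}
    {π : H →ₗ[k] (Fin r → k)} (h : LinearMap.det (π ∘ₗ T ∘ₗ ι) ≠ 0) :
    r ≤ finrank k (LinearMap.range T) := by
  have hs : Function.Injective (π ∘ₗ T ∘ₗ ι) :=
    (LinearMap.equivOfDetNeZero _ h).injective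
  have hs' : Function.Injective (T.rangeRestrict ∘ₗ ι) := by
    intro a b hab
    apply hs
    have := congrArg (fun z : LinearMap.range T => π z.1) hab
    simpa using this
  simpa using LinearMap.finrank_le_finrank_of_injective hs'

/-- When `r` is the exact rank, a nonzero minor makes `π` injective on the range, so the `r`
equations `π (T w) = 0` imply all the others. -/
theorem eq_zero_of_det_ne_zero [Module.Finite k H] {T : W →ₗ[k] H} {r : ℕ} {ι : (Fin r → k) →ₗ[k] W}
    {π : H →ₗ[k] (Fin r → k)} (h : LinearMap.det (π ∘ₗ T ∘ₗ ι) ≠ 0)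
    (hr : finrank k (LinearMap.range T) = r) {w : W} (hw : π (T w) = 0) : T w = 0 := by
  have hs : Function.Surjective (π ∘ₗ T ∘ₗ ι) :=
    (LinearMap.equivOfDetNeZero _ h).surjective
  have hs' : Function.Surjective (π ∘ₗ (LinearMap.range T).subtype) := fun z => by
    obtain ⟨s, rfl⟩ := hs z
    exact ⟨⟨T (ι s), LinearMap.mem_range_self _ _⟩, rfl⟩
  have hi := (LinearMap.injective_iff_surjective_of_finrank_eq_finrank (by simpa using hr)).2 hs'
  have := @hi ⟨T w, LinearMap.mem_range_self _ _⟩ 0 (by simpa using hw)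
  exact congrArg Subtype.val this

end Linear

theorem isUnit_iff_det_mul_ne_zero {k W : Type*} [Field k] [Ring W] [Algebra k W]
    [Module.Finite k W] {w : W} : IsUnit w ↔ LinearMap.det (LinearMap.mul k W w) ≠ 0 := by
  constructor
  · rintro ⟨g, rfl⟩ h0
    have h : LinearMap.mul k W g ∘ₗ LinearMap.mul k W (g⁻¹ : Wˣ) = LinearMap.id := by
      ext v
      simp
    have := congrArg LinearMap.det h
    rw [LinearMap.det_comp, h0, LinearMap.det_id, zero_mul] at this
    exact zero_ne_one this
  · intro h
    let e := LinearMap.equivOfDetNeZero _ h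
    have he : ∀ v, e v = w * v := fun v => rfl
    obtain ⟨v, hv⟩ := e.surjective 1
    rw [he] at hv
    refine ⟨⟨w, v, hv, e.injective ?_⟩, rfl⟩
    rw [he, he, ← mul_assoc, hv, one_mul, mul_one]

/-- A bimodule over an algebra, given by its left and right multiplications. -/
structure BimoduleData (k W H : Type*) [Field k] [Ring W] [Algebra k W] [AddCommGroup H]
    [Module k H] where
  /-- The left multiplication. -/
  lam : W →ₗ[k] H →ₗ[k] H
  /-- The right multiplication. -/
  mu : W →ₗ[k] H →ₗ[k] H
  lam_one : ∀ h, lam 1 h = h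
  lam_mul : ∀ a b h, lam (a * b) h = lam a (lam b h)
  mu_one : ∀ h, mu 1 h = h
  mu_mul : ∀ a b h, mu (a * b) h = mu b (mu a h)
  lam_mu : ∀ a b h, lam a (mu b h) = mu b (lam a h)

namespace BimoduleData

variable {k : Type u} {W H : Type*} [Field k] [Ring W] [Algebra k W] [AddCommGroup H]
  [Module k H] (B : BimoduleData k W H)

/-- The map `w ↦ w h - h' w`. -/
def inter (h h' : H) : W →ₗ[k] H := B.lam.flip h - B.mu.flip h'

theorem inter_apply (h h' : H) (w : W) : B.inter h h' w = B.lam w h - B.mu w h' := rfl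

/-- Conjugacy under the units of the algebra. -/
def Conj (h h' : H) : Prop := ∃ g : Wˣ, B.lam g h = B.mu g h'

variable {B}

theorem lam_inv_lam (g : Wˣ) (h : H) : B.lam (g⁻¹ : Wˣ) (B.lam g h) = h := by
  rw [← B.lam_mul, Units.inv_mul, B.lam_one]

theorem lam_lam_inv (g : Wˣ) (h : H) : B.lam g (B.lam (g⁻¹ : Wˣ) h) = h := by
  rw [← B.lam_mul, Units.mul_inv, B.lam_one]

theorem mu_inv_mu (g : Wˣ) (h : H) : B.mu (g⁻¹ : Wˣ) (B.mu g h) = h := by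
  rw [← B.mu_mul, Units.mul_inv, B.mu_one]

theorem mu_mu_inv (g : Wˣ) (h : H) : B.mu g (B.mu (g⁻¹ : Wˣ) h) = h := by
  rw [← B.mu_mul, Units.inv_mul, B.mu_one]

theorem Conj.symm {h h' : H} (hc : B.Conj h h') : B.Conj h' h := by
  obtain ⟨g, hg⟩ := hc
  refine ⟨g⁻¹, ?_⟩
  rw [← mu_inv_mu (B := B) g (B.lam (g⁻¹ : Wˣ) h'), ← B.lam_mu, ← hg, lam_inv_lam]

theorem Conj.trans {h h' h'' : H} (hc : B.Conj h h') (hc' : B.Conj h' h'') : B.Conj h h'' := by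
  obtain ⟨g, hg⟩ := hc
  obtain ⟨g', hg'⟩ := hc'
  refine ⟨g' * g, ?_⟩
  rw [Units.val_mul, B.lam_mul, hg, B.lam_mu, hg', B.mu_mul]

/-- If `g a = a' g` and `f b = b' f`, then `w a' - b' w = f (w' a - b w') g⁻¹` for `w' = f⁻¹ w g`.
-/
theorem finrank_range_inter_le [Module.Finite k H] {a a' b b' : H} (ha : B.Conj a a')
    (hb : B.Conj b b') : finrank k (LinearMap.range (B.inter a' b')) ≤
      finrank k (LinearMap.range (B.inter a b)) := by
  obtain ⟨g, hg⟩ := ha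
  obtain ⟨f, hf⟩ := hb
  have h : LinearMap.range (B.inter a' b') ≤
      (LinearMap.range (B.inter a b)).map (B.lam f ∘ₗ B.mu (g⁻¹ : Wˣ)) := by
    rintro _ ⟨w, rfl⟩
    refine ⟨_, ⟨(f⁻¹ : Wˣ) * w * g, rfl⟩, ?_⟩
    rw [inter_apply, inter_apply, map_sub, LinearMap.comp_apply, LinearMap.comp_apply]
    congr 1
    · rw [B.lam_mul, B.lam_mul, hg, B.lam_mu, B.lam_mu, lam_lam_inv, mu_inv_mu]
    · rw [B.mu_mul, B.mu_mul, mu_inv_mu, B.lam_mu, B.lam_mu, hf, mu_inv_mu]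
  exact (Submodule.finrank_mono h).trans (Submodule.finrank_map_le _ _)

theorem finrank_range_inter_eq [Module.Finite k H] {a a' b b' : H} (ha : B.Conj a a')
    (hb : B.Conj b b') : finrank k (LinearMap.range (B.inter a' b')) =
      finrank k (LinearMap.range (B.inter a b)) :=
  (finrank_range_inter_le ha hb).antisymm (finrank_range_inter_le ha.symm hb.symm)

theorem det_mu_ne_zero {w : W} (hw : IsUnit w) : LinearMap.det (B.mu w) ≠ 0 := by
  obtain ⟨g, rfl⟩ := hw
  intro h0
  have h : B.mu g ∘ₗ B.mu (g⁻¹ : Wˣ) = LinearMap.id := by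
    ext v
    simp [mu_mu_inv]
  have := congrArg LinearMap.det h
  rw [LinearMap.det_comp, h0, LinearMap.det_id, zero_mul] at this
  exact zero_ne_one this

theorem conj_refl (h : H) : B.Conj h h := ⟨1, by rw [Units.val_one, B.lam_one, B.mu_one]⟩

variable (B) in
-- The map is affine in `h`. The form `c h + v` covers both a fixed first argument (`c = 0`), for
-- the slice, and the diagonal (`c = id`, `v = 0`), for semicontinuity.
theorem isRegMap_inter [Module.Finite k W] [Module.Finite k H] {r : ℕ}
    (ι : (Fin r → k) →ₗ[k] W) (π : H →ₗ[k] (Fin r → k)) (c : H →ₗ[k] H) (v : H) :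
    IsRegMap (polyFun k H) fun h => π ∘ₗ B.inter (c h + v) h ∘ₗ ι := by
  let L : H →ₗ[k] (Fin r → k) →ₗ[k] (Fin r → k) :=
    { toFun := fun h => π ∘ₗ B.inter (c h) h ∘ₗ ι
      map_add' := fun a b => by
        ext
        simp [inter_apply]
        ring
      map_smul' := fun a b => by
        ext
        simp [inter_apply]
        ring }
  have h : (fun h => π ∘ₗ B.inter (c h + v) h ∘ₗ ι) =
      fun h => L h + π ∘ₗ B.inter v 0 ∘ₗ ι := by
    funext h
    ext
    simp [inter_apply, L]
    ring
  rw [h]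
  exact (isRegMap_id.comp_linear L).add (.const _)

variable (B) in
/-- A rational parametrization of a neighbourhood of `h` in its conjugacy class, with a rational
inverse. -/
theorem exists_slice [Module.Finite k W] [Module.Finite k H] (h : H) {r : ℕ}
    (hr : finrank k (LinearMap.range (B.inter h h)) = r) :
    ∃ (E : H → Fin r → k) (D G : H → k) (F : (Fin r → k) → H) (d d₀ : (Fin r → k) → k),
      IsRegMap (polyFun k H) E ∧ D ∈ polyFun k H ∧ G ∈ polyFun k H ∧
      IsRegMap (polyFun k (Fin r → k)) F ∧ d ∈ polyFun k (Fin r → k) ∧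
      d₀ ∈ polyFun k (Fin r → k) ∧ D h ≠ 0 ∧ G h ≠ 0 ∧ E h = 0 ∧
      (∀ h', B.Conj h h' → D h' ≠ 0 → G h' ≠ 0 → ∀ s, s = (D h')⁻¹ • E h' →
        d s ≠ 0 ∧ h' = (d s)⁻¹ • F s ∧ d₀ s ≠ 0) ∧
      (∀ s, d₀ s ≠ 0 → ∀ h', h' = (d s)⁻¹ • F s →
        d s ≠ 0 ∧ B.Conj h h' ∧ D h' ≠ 0 ∧ G h' ≠ 0 ∧ s = (D h')⁻¹ • E h') := by
  obtain ⟨ι, π, hιπ⟩ := exists_comp_comp_eq_id (B.inter h h) hr.ge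
  -- For `w = 1 + ι s`, the image under `π` of the equation `w h = h' w` is the square linear system
  -- `M h' s = π (h' - h)`.
  let M : H → (Fin r → k) →ₗ[k] (Fin r → k) := fun h' => π ∘ₗ B.inter h h' ∘ₗ ι
  have hM : IsRegMap (polyFun k H) M := by simpa using B.isRegMap_inter ι π 0 h
  have hv : IsRegMap (polyFun k H) fun h' => π (h' - h) :=
    (isRegMap_id.sub (.const h)).comp_linear π
  obtain ⟨E, hE, hE'⟩ := hM.exists_solution hv
  let D : H → k := fun h' => LinearMap.det (M h')
  have hD : D ∈ polyFun k H := hM.det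
  -- Where `D ≠ 0`, non-vanishing of `G` says that the solution `1 + ι (E / D)` is a unit; the
  -- factor `D` makes the condition polynomial.
  let G : H → k := fun h' => LinearMap.det (LinearMap.mul k W (D h' • 1 + ι (E h')))
  have hG : G ∈ polyFun k H := IsRegMap.det
    (((IsRegMap.smul hD (.const 1)).add (hE.comp_linear ι)).comp_linear (LinearMap.mul k W))
  have hG' : ∀ h', D h' ≠ 0 → (G h' ≠ 0 ↔ IsUnit (1 + ι ((D h')⁻¹ • E h'))) := by
    intro h' hD'
    rw [← isUnit_iff_det_mul_ne_zero]
    have : D h' • (1 : W) + ι (E h') = Units.mk0 _ hD' • (1 + ι ((D h')⁻¹ • E h')) := by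
      rw [Units.smul_def, Units.val_mk0, smul_add, ← map_smul, smul_smul, mul_inv_cancel₀ hD',
        one_smul]
    rw [this]
    exact isUnit_smul_iff _ _
  let c : (Fin r → k) → W := fun s => 1 + ι s
  have hc : IsRegMap (polyFun k (Fin r → k)) c := (IsRegMap.const 1).add (isRegMap_id.comp_linear ι)
  have hmu : IsRegMap (polyFun k (Fin r → k)) fun s => B.mu (c s) := hc.comp_linear B.mu
  have hlam : IsRegMap (polyFun k (Fin r → k)) fun s => B.lam (c s) h :=
    hc.comp_linear (B.lam.flip h)
  obtain ⟨F, hF, hF'⟩ := hmu.exists_solution hlam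
  -- `Q` expresses the condition `D h' ≠ 0` at `h' = F s / d s` as a polynomial condition on `s`.
  obtain ⟨Q, hQ, hQ'⟩ := hF.exists_pullback hmu.det hD
  have hinter : ∀ h' s, M h' s - π (h' - h) = π (B.inter h h' (c s)) := by
    intro h' s
    simp only [M, c, map_add, map_sub, LinearMap.comp_apply, inter_apply, B.lam_one, B.mu_one]
    abel
  have hMh : M h = LinearMap.id := hιπ
  have hDh : D h ≠ 0 := by simp [D, hMh]
  have hEh : E h = 0 := by
    have := (hE' h hDh 0).1 (by simp)
    have h2 := congrArg (fun z => D h • z) this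
    simpa [D, smul_smul, hDh] using h2.symm
  -- The factors of `d₀` say that `c s` is a unit, that right multiplication by it is invertible,
  -- and that the resulting `h'` satisfies `D h' ≠ 0`.
  refine ⟨E, D, G, F, fun s => LinearMap.det (B.mu (c s)),
    (fun s => LinearMap.det (LinearMap.mul k W (c s))) * (fun s => LinearMap.det (B.mu (c s))) * Q,
    hE, hD, hG, hF, hmu.det,
    mul_mem (mul_mem (hc.comp_linear (LinearMap.mul k W)).det hmu.det) hQ, hDh, ?_, hEh, ?_, ?_⟩
  · rw [hG' h hDh, hEh]
    simp
  · rintro h' hh' hD' hG'' s hs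
    have hu : IsUnit (c s) := by
      rw [hs]
      exact (hG' h' hD').1 hG''
    have hd := det_mu_ne_zero (B := B) hu
    -- Conjugacy of `h` and `h'` gives `B.inter h h'` rank exactly `r`, so solving the projected
    -- system solves the whole equation.
    have h1 : B.inter h h' (c s) = 0 := by
      refine eq_zero_of_det_ne_zero (ι := ι) (π := π) hD' ?_ ?_
      · rw [← hr]
        exact finrank_range_inter_eq (conj_refl h) hh'
      · rw [← hinter, sub_eq_zero]
        exact (hE' h' hD' s).2 hs
    rw [inter_apply, sub_eq_zero] at h1
    have h2 := (hF' s hd h').1 h1.symm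
    refine ⟨hd, h2, mul_ne_zero (mul_ne_zero (isUnit_iff_det_mul_ne_zero.1 hu) hd) ?_⟩
    rw [Ne, hQ' s hd, ← h2]
    exact hD'
  · rintro s hs h' hh'
    have hd : LinearMap.det (B.mu (c s)) ≠ 0 := right_ne_zero_of_mul (left_ne_zero_of_mul hs)
    have hu : IsUnit (c s) :=
      isUnit_iff_det_mul_ne_zero.2 (left_ne_zero_of_mul (left_ne_zero_of_mul hs))
    have hD' : D h' ≠ 0 := by
      rw [hh', Ne, ← hQ' s hd]
      exact right_ne_zero_of_mul hs
    have h1 := (hF' s hd h').2 hh'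
    have h2 : s = (D h')⁻¹ • E h' := by
      rw [← hE' h' hD', ← sub_eq_zero, hinter, inter_apply, h1, sub_self, map_zero]
    refine ⟨hd, ⟨hu.unit, h1.symm⟩, hD', ?_, h2⟩
    rw [hG' h' hD', ← h2]
    exact hu

end BimoduleData

end DerivedSemicont

namespace DerivedSemicont

open Module LinearAlgebra.Projectivization

/-! ### Dimension and semicontinuity of conjugacy classes in projective space. -/

theorem exists_dual_eq_one {k V : Type*} [Field k] [AddCommGroup V] [Module k V] {h : V}
    (h0 : h ≠ 0) : ∃ l : Dual k V, l h = 1 := by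
  obtain ⟨φ, hφ⟩ : ∃ φ : Dual k V, φ h ≠ 0 := by
    by_contra! hφ
    exact h0 ((Module.forall_dual_apply_eq_zero_iff k h).1 hφ)
  exact ⟨(φ h)⁻¹ • φ, by simp [hφ]⟩

/-- The restriction of `q` to the line through `h` is a polynomial in one variable, nonzero at `1`;
over an infinite field its product with `X (X - 1)` is nonzero somewhere. -/
theorem exists_smul_ne_zero {k V : Type*} [Field k] [Infinite k] [AddCommGroup V] [Module k V]
    {q : V → k} (hq : q ∈ polyFun k V) {h : V} (hqh : q h ≠ 0) :
    ∃ a : k, a ≠ 0 ∧ a ≠ 1 ∧ q (a • h) ≠ 0 := by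
  obtain ⟨p, hp⟩ := mem_polyFun.1 hq
  let P : Polynomial k := MvPolynomial.aeval
    (fun φ : Dual k V => Polynomial.C (φ h) * Polynomial.X) p
  have hP : ∀ a, P.eval a = q (a • h) := by
    intro a
    rw [← hp, polyEval, ← MvPolynomial.coe_aeval_eq_eval, ← Polynomial.coe_aeval_eq_eval]
    change ((Polynomial.aeval a).comp (MvPolynomial.aeval _)) p = MvPolynomial.aeval _ p
    congr 1
    refine MvPolynomial.algHom_ext fun φ => ?_
    rw [AlgHom.comp_apply, MvPolynomial.aeval_X, MvPolynomial.aeval_X,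
      Polynomial.coe_aeval_eq_eval, Polynomial.eval_mul, Polynomial.eval_C, Polynomial.eval_X,
      map_smul, smul_eq_mul, mul_comm]
  have hP0 : P ≠ 0 := by
    intro h0
    apply hqh
    rw [← one_smul k h, ← hP, h0, Polynomial.eval_zero]
  have hne : Polynomial.X * (Polynomial.X - Polynomial.C 1) * P ≠ 0 :=
    mul_ne_zero (mul_ne_zero Polynomial.X_ne_zero (Polynomial.X_sub_C_ne_zero 1)) hP0
  obtain ⟨a, ha⟩ : ∃ a, (Polynomial.X * (Polynomial.X - Polynomial.C 1) * P).eval a ≠ 0 := by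
    by_contra! h
    exact hne (Polynomial.funext fun a => by rw [h, Polynomial.eval_zero])
  simp only [Polynomial.eval_mul, Polynomial.eval_X, Polynomial.eval_sub, Polynomial.eval_C, hP]
    at ha
  exact ⟨a, left_ne_zero_of_mul (left_ne_zero_of_mul ha),
    sub_ne_zero.1 (right_ne_zero_of_mul (left_ne_zero_of_mul ha)), right_ne_zero_of_mul ha⟩

theorem exists_nat_of_add_one_eq {a : WithBot ℕ∞} {n : ℕ} (h : a + 1 = n) :
    ∃ m : ℕ, m + 1 = n ∧ a = m := by
  induction a using WithBot.recBotCoe with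
  | bot => simp at h
  | coe a =>
    induction a using ENat.recTopCoe with
    | top =>
      have h : (⊤ : ℕ∞) + 1 = n := WithBot.coe_injective h
      simp at h
    | coe m => exact ⟨m, by exact_mod_cast h, rfl⟩

namespace BimoduleData

variable {k : Type u} {W : Type*} {H : Type w} [Field k] [Ring W] [Algebra k W] [AddCommGroup H]
  [Module k H] {B : BimoduleData k W H}
  {𝔇 : Set (ℙ k H)}

/-- The locus of the points of `𝔇` which are conjugate to a given point. -/
abbrev conjClass (B : BimoduleData k W H) {𝔇 : Set (ℙ k H)} (x : 𝔇) : Set 𝔇 :=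
  {y | B.Conj x.1.rep y.1.rep}

theorem conj_affineRep (hscale : ∀ (h : H) (a : k), a ≠ 0 → B.Conj h (a • h)) {l : Dual k H}
    {x : ℙ k H} (hl : l x.rep ≠ 0) : B.Conj x.rep (affineRep l x) :=
  hscale _ _ (inv_ne_zero hl)

variable [Module.Finite k W] [Module.Finite k H]

/-- In the slice coordinates at `h`, normalizing lines by `l = 1` identifies a neighbourhood of `y₀`
with the part `d₀ ≠ 0` of the hypersurface `l (F s) = d s` of `k^r`, which passes through the
origin, the image of `y₀`. -/
theorem exists_isOpen_topologicalKrullDim [IsAlgClosed k]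
    (hscale : ∀ (h : H) (a : k), a ≠ 0 → B.Conj h (a • h))
    (hD : ∀ x ∈ 𝔇, ∀ y : ℙ k H, B.Conj x.rep y.rep → y ∈ 𝔇) {r : ℕ} (x : 𝔇)
    (hr : finrank k (LinearMap.range (B.inter x.1.rep x.1.rep)) = r) (y₀ : B.conjClass x) :
    ∃ U : Set (B.conjClass x), IsOpen U ∧ y₀ ∈ U ∧ topologicalKrullDim U + 1 = r := by
  have : Infinite k := IsAlgClosed.instInfinite
  set h := y₀.1.1.rep with hh
  have h0 : h ≠ 0 := y₀.1.1.rep_nonzero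
  obtain ⟨l, hl⟩ := exists_dual_eq_one (k := k) h0
  have hxh : B.Conj x.1.rep h := y₀.2
  obtain ⟨E, D, G, F, d, d₀, hE, hDr, hG, hF, hd, hd₀, hDh, hGh, hEh, h1, h2⟩ :=
    B.exists_slice h ((finrank_range_inter_eq hxh hxh).trans hr)
  let j : B.conjClass x → ℙ k H := fun y => y.1.1
  have hj : Topology.IsInducing j :=
    Topology.IsInducing.subtypeVal.comp Topology.IsInducing.subtypeVal
  let U : Set (B.conjClass x) :=
    j ⁻¹' {z | l z.rep ≠ 0 ∧ (D * G) (affineRep l z) ≠ 0}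
  have hU : IsOpen U := (isOpen_affineRep_ne_zero l (mul_mem hDr hG)).preimage hj.continuous
  let κ : U → H := fun y => affineRep l (j y)
  have hκ : IsChart (polyFun k H) κ :=
    isChart_affineRep (hj.comp Topology.IsInducing.subtypeVal) l fun y => y.2.1
  have hlκ : ∀ y, l (κ y) = 1 := fun y => by
    simp only [κ, affineRep, map_smul, smul_eq_mul]
    exact inv_mul_cancel₀ y.2.1
  have hDκ : ∀ y, D (κ y) ≠ 0 := fun y => left_ne_zero_of_mul y.2.2
  have hGκ : ∀ y, G (κ y) ≠ 0 := fun y => right_ne_zero_of_mul y.2.2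
  have hcκ : ∀ y, B.Conj h (κ y) := fun y =>
    hxh.symm.trans (y.1.2.trans (conj_affineRep hscale y.2.1))
  let e : U → Fin r → k := fun y => (D (κ y))⁻¹ • E (κ y)
  have he := fun y => h1 (κ y) (hcκ y) (hDκ y) (hGκ y) (e y) rfl
  have hechart : IsAffineChart e := (hκ.transfer hF hd (fun y => (he y).1) (fun y => (he y).2.1)
    hE hDr hDκ fun y => rfl).isAffineChart
  obtain ⟨p, hp⟩ := mem_polyFun_pi.1 (sub_mem (hF l) hd)
  obtain ⟨p₀, hp₀⟩ := mem_polyFun_pi.1 hd₀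
  have hp : ∀ s, MvPolynomial.eval s p = l (F s) - d s := hp
  have hl_iff : ∀ s, d s ≠ 0 → (l ((d s)⁻¹ • F s) = 1 ↔ MvPolynomial.eval s p = 0) := by
    intro s hs
    rw [hp, map_smul, smul_eq_mul, inv_mul_eq_one₀ hs, sub_eq_zero, eq_comm]
  have hzero : (0 : Fin r → k) = (D h)⁻¹ • E h := by rw [hEh, smul_zero]
  have hslice0 := h1 h (conj_refl h) hDh hGh 0 hzero
  refine ⟨U, hU, ⟨by simp [j, ← hh, hl], ?_⟩, le_antisymm ?_ ?_⟩
  · have : affineRep l (j y₀) = h := by simp [affineRep, j, ← hh, hl]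
    rw [this]
    exact mul_ne_zero hDh hGh
  · refine topologicalKrullDim_add_one_le hechart (F := p) ?_ fun y => ?_
    -- If the equation were trivial, `l` would equal `1` on the whole parametrized part of the
    -- orbit. But that part contains some `a • h` with `a ≠ 1`, and `l (a • h) = a`.
    · rintro rfl
      obtain ⟨a, ha0, ha1, ha⟩ := exists_smul_ne_zero (mul_mem hDr hG) (mul_ne_zero hDh hGh)
      obtain ⟨hd', hF', -⟩ := h1 (a • h) (hscale h a ha0) (left_ne_zero_of_mul ha)
        (right_ne_zero_of_mul ha) _ rfl
      have := (hl_iff _ hd').2 (map_zero _)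
      rw [← hF', map_smul, hl, smul_eq_mul, mul_one] at this
      exact ha1 this
    · rw [← hl_iff _ (he y).1, ← (he y).2.1, hlκ]
  · refine le_topologicalKrullDim_add_one hechart (F := p) (d := p₀) (fun s hs hs' => ?_) ?_ ?_
    -- Each point of the hypersurface with `d₀ ≠ 0` yields a vector conjugate to `h`; its line lies
    -- in `𝔇` by `hD`, and in the class because scalars are absorbed.
    · rw [hp₀] at hs'
      obtain ⟨hds, hc, hDs, hGs, hEs⟩ := h2 s hs' _ rfl
      set h' := (d s)⁻¹ • F s with hh'
      have hl' : l h' = 1 := (hl_iff s hds).2 hs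
      have h0' : h' ≠ 0 := by
        intro h0'
        rw [h0', map_zero] at hl'
        exact zero_ne_one hl'
      have hrep := affineRep_eq h0' hl'
      let z : ℙ k H := Projectivization.mk k h' h0'
      have hlz : l z.rep ≠ 0 := by
        intro hlz
        change affineRep l z = h' at hrep
        rw [affineRep, hlz, inv_zero, zero_smul] at hrep
        exact h0' hrep.symm
      have hxz : B.Conj x.1.rep z.rep := by
        refine (hxh.trans hc).trans ?_
        rw [← hrep]
        exact (conj_affineRep hscale hlz).symm
      let y : B.conjClass x := ⟨⟨z, hD x.1 x.2 z hxz⟩, hxz⟩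
      have hjy : affineRep l (j y) = h' := hrep
      refine ⟨⟨y, hlz, ?_⟩, ?_⟩
      · rw [hjy]
        exact mul_ne_zero hDs hGs
      · simp only [e, κ, hjy]
        exact hEs.symm
    · rw [← hl_iff _ hslice0.1, ← hslice0.2.1, hl]
    · rw [hp₀]
      exact hslice0.2.2

/-- The dimension of a conjugacy class in the projective space. -/
theorem topologicalKrullDim_conjClass [IsAlgClosed k]
    (hscale : ∀ (h : H) (a : k), a ≠ 0 → B.Conj h (a • h))
    (hD : ∀ x ∈ 𝔇, ∀ y : ℙ k H, B.Conj x.rep y.rep → y ∈ 𝔇) (x : 𝔇) :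
    ∃ m : ℕ, m + 1 = finrank k (LinearMap.range (B.inter x.1.rep x.1.rep)) ∧
      topologicalKrullDim (B.conjClass x) = m := by
  obtain ⟨U, -, -, hU⟩ :=
    exists_isOpen_topologicalKrullDim hscale hD x rfl ⟨x, conj_refl x.1.rep⟩
  obtain ⟨m, hm, hUm⟩ := exists_nat_of_add_one_eq hU
  refine ⟨m, hm, le_antisymm (topologicalKrullDim_le_of_forall_exists_isOpen fun y => ?_) ?_⟩
  · obtain ⟨V, hVo, hyV, hV⟩ := exists_isOpen_topologicalKrullDim hscale hD x rfl y
    obtain ⟨m', hm', hVm⟩ := exists_nat_of_add_one_eq hV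
    exact ⟨V, hVo, hyV, by rw [hVm, Nat.succ_injective (hm.trans hm'.symm)]⟩
  · rw [← hUm]
    exact topologicalKrullDim_subspace_le _ U

theorem isClosed_topologicalKrullDim_conjClass_le [IsAlgClosed k]
    (hscale : ∀ (h : H) (a : k), a ≠ 0 → B.Conj h (a • h))
    (hD : ∀ x ∈ 𝔇, ∀ y : ℙ k H, B.Conj x.rep y.rep → y ∈ 𝔇) (i : ℕ) :
    IsClosed {x : 𝔇 | topologicalKrullDim (B.conjClass x) ≤ (i : WithBot ℕ∞)} := by
  -- The dimension is the rank minus one, so it exceeds `i` exactly when the rank is at least `i +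
  -- 2`.
  have hset : {x : 𝔇 | topologicalKrullDim (B.conjClass x) ≤ (i : WithBot ℕ∞)} =
      {x : 𝔇 | i + 2 ≤ finrank k (LinearMap.range (B.inter x.1.rep x.1.rep))}ᶜ := by
    ext x
    obtain ⟨m, hm, hdim⟩ := topologicalKrullDim_conjClass hscale hD x
    rw [Set.mem_compl_iff, Set.mem_ofPred_eq, Set.mem_ofPred_eq, hdim, ← hm]
    norm_cast
    omega
  rw [hset, isClosed_compl_iff, isOpen_iff_forall_mem_open]
  intro x hx
  obtain ⟨ι, π, hιπ⟩ := exists_comp_comp_eq_id _ hx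
  obtain ⟨l, hl⟩ := exists_dual_eq_one (k := k) x.1.rep_nonzero
  have hq : (fun h => LinearMap.det (π ∘ₗ B.inter h h ∘ₗ ι)) ∈ polyFun k H := by
    have := (B.isRegMap_inter ι π LinearMap.id 0).det
    simpa using this
  -- The neighbourhood is where the minor chosen at `x` stays invertible; evaluating it on
  -- `affineRep` is harmless since conjugate vectors give equal ranks.
  refine ⟨_, fun y hy => ?_,
    (isOpen_affineRep_ne_zero l hq).preimage continuous_subtype_val, ?_⟩
  · have hc := conj_affineRep (B := B) hscale hy.1
    have := le_finrank_range_of_det_ne_zero hy.2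
    rwa [finrank_range_inter_eq hc hc] at this
  · have : affineRep l x.1 = x.1.rep := by simp [affineRep, hl]
    simp [this, hl, hιπ]

end BimoduleData

end DerivedSemicont

namespace DerivedSemicont

/-! ### Isomorphism of complexes as conjugacy in a bimodule. -/

section Application

open Module

section Basic

variable {A : Type v} [Ring A] {M N : Type w} [AddCommGroup M] [Module Aᵐᵒᵖ M]
  [AddCommGroup N] [Module Aᵐᵒᵖ N]

theorem map_mem_mulIdeal (I : Ideal A) (f : M →ₗ[Aᵐᵒᵖ] N) {x : M} (hx : x ∈ mulIdeal I M) :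
    f x ∈ mulIdeal I N := by
  refine Submodule.span_induction (p := fun x _ => f x ∈ mulIdeal I N) ?_ ?_ ?_ ?_ hx
  · rintro _ ⟨y, a, ha, rfl⟩
    rw [map_smul]
    exact Submodule.subset_span ⟨f y, a, ha, rfl⟩
  · rw [map_zero]
    exact zero_mem _
  · intro y z _ _ hy hz
    rw [map_add]
    exact add_mem hy hz
  · intro a y _ hy
    rw [map_smul]
    exact Submodule.smul_mem _ _ hy

theorem finite_linearMap_of_isScalarTower (k : Type u) [Field k] [Algebra k A] [Module k M]
    [Module k N] [IsScalarTower k Aᵐᵒᵖ M] [IsScalarTower k Aᵐᵒᵖ N] [Module.Finite k M]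
    [Module.Finite k N] : Module.Finite k (M →ₗ[Aᵐᵒᵖ] N) :=
  Module.Finite.of_injective (LinearMap.restrictScalarsₗ k Aᵐᵒᵖ M N k)
    (LinearMap.restrictScalars_injective k)

theorem exists_linearEquiv_comm_iff {R : Type*} [Ring R] {S S' T T' : ℤ → Type*}
    [∀ l, AddCommGroup (S l)] [∀ l, Module R (S l)] [∀ l, AddCommGroup (S' l)]
    [∀ l, Module R (S' l)] [∀ l, AddCommGroup (T l)] [∀ l, Module R (T l)]
    [∀ l, AddCommGroup (T' l)] [∀ l, Module R (T' l)]
    (dS : ∀ l, S (l + 1) →ₗ[R] S l) (dS' : ∀ l, S' (l + 1) →ₗ[R] S' l)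
    (dT : ∀ l, T (l + 1) →ₗ[R] T l) (dT' : ∀ l, T' (l + 1) →ₗ[R] T' l)
    (a : ∀ l, S l ≃ₗ[R] T l) (a' : ∀ l, S' l ≃ₗ[R] T' l)
    (ha : ∀ l f, a l (dS l f) = dT l (a (l + 1) f))
    (ha' : ∀ l f, a' l (dS' l f) = dT' l (a' (l + 1) f)) :
    (∃ e : ∀ l, S l ≃ₗ[R] S' l, ∀ l f, e l (dS l f) = dS' l (e (l + 1) f)) ↔
      ∃ g : ∀ l, T l ≃ₗ[R] T' l, ∀ l v, g l (dT l v) = dT' l (g (l + 1) v) := by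
  constructor
  · rintro ⟨e, he⟩
    refine ⟨fun l => ((a l).symm.trans (e l)).trans (a' l), fun l v => ?_⟩
    obtain ⟨f, rfl⟩ := (a (l + 1)).surjective v
    simp only [LinearEquiv.trans_apply, ← ha, LinearEquiv.symm_apply_apply, he, ha']
  · rintro ⟨g, hg⟩
    refine ⟨fun l => ((a l).trans (g l)).trans (a' l).symm, fun l f => ?_⟩
    apply (a' l).injective
    simp only [LinearEquiv.trans_apply, ha', LinearEquiv.apply_symm_apply, ha, hg]

end Basic

section TwistFibre

variable {k : Type u} [Field k] {A : Type v} [Ring A] [Algebra k A]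
  {V : Type w} [AddCommGroup V] [Module k V] {M : Type w} [AddCommGroup M] [Module Aᵐᵒᵖ M]
  [Module k M] [IsScalarTower k Aᵐᵒᵖ M]

theorem rep_mem_submodule (x : ℙ k V) : x.rep ∈ x.submodule := by
  rw [Projectivization.submodule_eq]
  exact Submodule.mem_span_singleton_self _

/-- The chosen representative, as a point of the punctured line. -/
noncomputable def repPoint (x : ℙ k V) : PuncturedLine x :=
  ⟨x.rep, rep_mem_submodule x, x.rep_nonzero⟩

theorem exists_units_smul_rep {x : ℙ k V} (h : PuncturedLine x) :
    ∃ c : kˣ, (h : V) = (c : k) • x.rep := by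
  obtain ⟨c, hc⟩ : ∃ c : k, c • x.rep = h := by
    rw [← Submodule.mem_span_singleton, ← Projectivization.submodule_eq]
    exact h.2.1
  have hc0 : c ≠ 0 := by
    rintro rfl
    exact h.2.2 (by rw [← hc, zero_smul])
  exact ⟨Units.mk0 c hc0, hc.symm⟩

variable (A M) in
/-- The evaluation of the fibre of `𝒪(j) ⊗ M` at the chosen representative. -/
noncomputable def twistFibreEquiv (x : ℙ k V) (j : ℤ) : twistFibre A x j M ≃ₗ[Aᵐᵒᵖ] M :=
  LinearEquiv.ofBijective
    (LinearMap.proj (repPoint x) ∘ₗ (twistFibre A x j M).subtype) (by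
      constructor
      · intro f g hfg
        ext h
        obtain ⟨c, hc⟩ := exists_units_smul_rep h
        have hfg : f.1 (repPoint x) = g.1 (repPoint x) := hfg
        rw [f.2 c (repPoint x) h hc, g.2 c (repPoint x) h hc, hfg]
      · intro v
        -- Each point of the punctured line is a unique multiple `c h` of the representative, so
        -- homogeneity forces the value `(c h) ^ j • v` there.
        choose c hc using fun h : PuncturedLine x => exists_units_smul_rep h
        have hinj : ∀ a b : kˣ, (a : k) • x.rep = (b : k) • x.rep → a = b := fun a b hab =>
          Units.ext (smul_left_injective k x.rep_nonzero hab)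
        refine ⟨⟨fun h => ((c h ^ j : kˣ) : k) • v, fun a h h' e => ?_⟩, ?_⟩
        · have : c h' = a * c h := hinj _ _ (by
            rw [← hc, e, Units.val_mul, mul_smul, ← hc])
          change ((c h' ^ j : kˣ) : k) • v = ((a ^ j : kˣ) : k) • ((c h ^ j : kˣ) : k) • v
          rw [this, mul_zpow, Units.val_mul, mul_smul]
        · have : c (repPoint x) = 1 := hinj _ _ (by
            rw [← hc, Units.val_one, one_smul]
            rfl)
          change ((c (repPoint x) ^ j : kˣ) : k) • v = v
          rw [this, one_zpow, Units.val_one, one_smul])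

end TwistFibre

variable {k : Type u} [Field k] {A : Type v} [Ring A] [Algebra k A]
  {t : ℕ} {P : Fin t → Type w} [∀ i, AddCommGroup (P i)] [∀ i, Module Aᵐᵒᵖ (P i)]
  [∀ i, Module k (P i)] [∀ i, IsScalarTower k Aᵐᵒᵖ (P i)]
  {I : Ideal A} {m n : ℤ} {r : ℤ → Fin t → ℕ}

theorem diff_of_mem (h : DiffSpace k P I m n r) {l : ℤ} (hl : l ∈ Set.Ico m n) :
    diff h l = (h ⟨l, hl⟩).1 := dif_pos hl

theorem diff_of_notMem (h : DiffSpace k P I m n r) {l : ℤ} (hl : l ∉ Set.Ico m n) :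
    diff h l = 0 := dif_neg hl

/-- No scalar appears, because all terms are evaluated at the same representative. -/
theorem twistFibreEquiv_canonicalDiff (x : ℙ k (DiffSpace k P I m n r)) (l : ℤ)
    (f : twistFibre A x (n - (l + 1)) (RankModule P (r (l + 1)))) :
    twistFibreEquiv A _ x (n - l) (canonicalDiff x l f) =
      diff x.rep l (twistFibreEquiv A _ x (n - (l + 1)) f) := rfl

theorem mem_varietyD_iff {x : ℙ k (DiffSpace k P I m n r)} :
    x ∈ varietyD k P I m n r ↔ ∀ l, (diff x.rep l).comp (diff x.rep (l + 1)) = 0 := by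
  refine ⟨fun hx => hx _ (rep_mem_submodule x), fun hx h hh l => ?_⟩
  rw [Projectivization.submodule_eq, Submodule.mem_span_singleton] at hh
  obtain ⟨c, rfl⟩ := hh
  refine LinearMap.ext fun v => ?_
  have := LinearMap.congr_fun (hx l) v
  simp only [LinearMap.comp_apply, LinearMap.zero_apply] at this
  rw [diff_smul, diff_smul, LinearMap.comp_apply, LinearMap.smul_apply, LinearMap.smul_apply,
    LinearMap.map_smul_of_tower, this, smul_zero, smul_zero, LinearMap.zero_apply]

theorem nonempty_iso_canonicalFamily_iff_twistFibre {x y : varietyD k P I m n r} :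
    Nonempty (canonicalFamily x ≅ canonicalFamily y) ↔
      ∃ e : ∀ l : ℤ, twistFibre A x.1 (n - l) (RankModule P (r l)) ≃ₗ[Aᵐᵒᵖ]
          twistFibre A y.1 (n - l) (RankModule P (r l)),
        ∀ l f, e l (canonicalDiff x.1 l f) = canonicalDiff y.1 l (e (l + 1) f) := by
  constructor
  · rintro ⟨e⟩
    refine ⟨fun l => ((HomologicalComplex.Hom.isoApp e l :
      canonicalTerm x l ≅ canonicalTerm y l)).toLinearEquiv, fun l f => ?_⟩
    have hcomm := e.hom.comm (l + 1) l
    simp only [canonicalFamily, ChainComplex.of_d] at hcomm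
    exact (congrArg (fun φ => φ.hom f) hcomm).symm
  · rintro ⟨e, he⟩
    refine ⟨HomologicalComplex.Hom.isoOfComponents
      (fun l => ((e l).toModuleIso : canonicalTerm x l ≅ canonicalTerm y l)) ?_⟩
    rintro i l (rfl : l + 1 = i)
    simp only [canonicalFamily, ChainComplex.of_d]
    exact ModuleCat.hom_ext (LinearMap.ext fun f => (he l f).symm)

/-- Isomorphisms of the fibres of the canonical family, in terms of the chosen representatives. -/
theorem nonempty_iso_canonicalFamily_iff {x y : varietyD k P I m n r} :
    Nonempty (canonicalFamily x ≅ canonicalFamily y) ↔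
      ∃ g : ∀ l, RankModule P (r l) ≃ₗ[Aᵐᵒᵖ] RankModule P (r l),
        ∀ l v, g l (diff x.1.rep l v) = diff y.1.rep l (g (l + 1) v) := by
  rw [nonempty_iso_canonicalFamily_iff_twistFibre]
  exact exists_linearEquiv_comm_iff (fun l => canonicalDiff x.1 l) (fun l => canonicalDiff y.1 l)
    (fun l => diff x.1.rep l) (fun l => diff y.1.rep l)
    (fun l => twistFibreEquiv A (RankModule P (r l)) x.1 (n - l))
    (fun l => twistFibreEquiv A (RankModule P (r l)) y.1 (n - l))
    (twistFibreEquiv_canonicalDiff x.1) (twistFibreEquiv_canonicalDiff y.1)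

variable (k P m n r) in
/-- The product of the endomorphism algebras of the terms. -/
abbrev EndProd : Type w := ∀ l : Set.Icc m n, Module.End Aᵐᵒᵖ (RankModule P (r l))

theorem mem_Icc_of_mem_Ico {l : ℤ} (hl : l ∈ Set.Ico m n) : l ∈ Set.Icc m n := ⟨hl.1, hl.2.le⟩

theorem add_one_mem_Icc_of_mem_Ico {l : ℤ} (hl : l ∈ Set.Ico m n) : l + 1 ∈ Set.Icc m n :=
  ⟨hl.1.trans (lt_add_one l).le, hl.2⟩

variable (k P I m n r) in
/-- The space of sequences of homomorphisms as a bimodule over the endomorphisms. -/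
def diffBimodule : BimoduleData k (EndProd (A := A) P m n r) (DiffSpace k P I m n r) where
  lam := LinearMap.mk₂ k
    (fun w h l => ⟨(w ⟨l, mem_Icc_of_mem_Ico l.2⟩).comp (h l).1,
      fun v => map_mem_mulIdeal I (w ⟨l, mem_Icc_of_mem_Ico l.2⟩) ((h l).2 v)⟩)
    (fun _ _ _ => by ext; rfl) (fun _ _ _ => by ext; rfl)
    (fun w h h' => by
      funext l
      ext1
      exact LinearMap.comp_add _ _ _)
    (fun c w h => by
      funext l
      ext1
      exact LinearMap.comp_smul _ _ _)
  mu := LinearMap.mk₂ k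
    (fun w h l => ⟨(h l).1.comp (w ⟨l + 1, add_one_mem_Icc_of_mem_Ico l.2⟩),
      fun v => (h l).2 _⟩)
    (fun w w' h => by
      funext l
      ext1
      exact LinearMap.comp_add _ _ _)
    (fun c w h => by
      funext l
      ext1
      exact LinearMap.comp_smul _ _ _)
    (fun _ _ _ => by ext; rfl) (fun _ _ _ => by ext; rfl)
  lam_one _ := rfl
  lam_mul _ _ _ := rfl
  mu_one _ := rfl
  mu_mul _ _ _ := rfl
  lam_mu _ _ _ := rfl

theorem conj_iff_exists_linearEquiv {h h' : DiffSpace k P I m n r} :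
    (diffBimodule k P I m n r).Conj h h' ↔
      ∃ g : ∀ l, RankModule P (r l) ≃ₗ[Aᵐᵒᵖ] RankModule P (r l),
        ∀ l v, g l (diff h l v) = diff h' l (g (l + 1) v) := by
  constructor
  · rintro ⟨u, hu⟩
    -- Outside `[m, n]` the adjacent differentials vanish, so any automorphism commutes with them;
    -- the identity is taken.
    let g : ∀ l, RankModule P (r l) ≃ₗ[Aᵐᵒᵖ] RankModule P (r l) := fun l =>
      if hl : l ∈ Set.Icc m n then
        LinearEquiv.ofLinearMap (u.1 ⟨l, hl⟩) ((u⁻¹).1 ⟨l, hl⟩)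
          (congrFun u.mul_inv ⟨l, hl⟩) (congrFun u.inv_mul ⟨l, hl⟩)
      else LinearEquiv.refl _ _
    have hg : ∀ l (hl : l ∈ Set.Icc m n) v, g l v = u.1 ⟨l, hl⟩ v := by
      intro l hl v
      simp only [g, dif_pos hl]
      rfl
    refine ⟨g, fun l v => ?_⟩
    by_cases hl : l ∈ Set.Ico m n
    · rw [hg l (mem_Icc_of_mem_Ico hl), hg (l + 1) (add_one_mem_Icc_of_mem_Ico hl),
        diff_of_mem _ hl, diff_of_mem _ hl]
      exact LinearMap.congr_fun (congrArg Subtype.val (congrFun hu ⟨l, hl⟩)) v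
    · rw [diff_of_notMem _ hl, diff_of_notMem _ hl]
      simp
  · rintro ⟨g, hg⟩
    refine ⟨⟨fun l => (g l : RankModule P (r l) →ₗ[Aᵐᵒᵖ] RankModule P (r l)),
      fun l => ((g l).symm : RankModule P (r l) →ₗ[Aᵐᵒᵖ] RankModule P (r l)), ?_, ?_⟩, ?_⟩
    · funext l
      exact LinearMap.ext fun v => (g l).apply_symm_apply v
    · funext l
      exact LinearMap.ext fun v => (g l).symm_apply_apply v
    · funext l
      refine Subtype.ext (LinearMap.ext fun v => ?_)
      have := hg l v
      rw [diff_of_mem _ l.2, diff_of_mem _ l.2] at this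
      exact this

theorem mem_varietyD_of_conj {x y : ℙ k (DiffSpace k P I m n r)}
    (hx : x ∈ varietyD k P I m n r) (hxy : (diffBimodule k P I m n r).Conj x.rep y.rep) :
    y ∈ varietyD k P I m n r := by
  obtain ⟨g, hg⟩ := conj_iff_exists_linearEquiv.1 hxy
  rw [mem_varietyD_iff] at hx ⊢
  intro l
  refine LinearMap.ext fun v => ?_
  obtain ⟨v, rfl⟩ := (g (l + 1 + 1)).surjective v
  have := LinearMap.congr_fun (hx l) v
  rw [LinearMap.comp_apply] at this ⊢
  rw [← hg, ← hg, this]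
  simp

/-- The automorphism `a ^ (-l)` of the `l`-th term works because `a ^ (-l) = a * a ^ (-(l + 1))`. -/
theorem conj_smul (h : DiffSpace k P I m n r) (a : k) (ha : a ≠ 0) :
    (diffBimodule k P I m n r).Conj h (a • h) := by
  rw [conj_iff_exists_linearEquiv]
  let c : ℤ → kˣ := fun l => Units.mk0 a ha ^ (-l)
  have hc : ∀ l, (c l : k) = (c (l + 1) : k) * a := by
    intro l
    have : c l = c (l + 1) * Units.mk0 a ha := by
      simp only [c, ← zpow_add_one]
      congr 1
      ring
    rw [this, Units.val_mul, Units.val_mk0]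
  refine ⟨fun l => LinearEquiv.ofLinearMap (((c l : kˣ) : k) • LinearMap.id)
    (((c l)⁻¹ : kˣ) • LinearMap.id) ?_ ?_, fun l v => ?_⟩
  · exact LinearMap.ext fun v => by simp [Units.smul_def, smul_smul]
  · exact LinearMap.ext fun v => by simp [Units.smul_def, smul_smul]
  · rw [diff_smul]
    change (c l : k) • diff h l v = a • diff h l ((c (l + 1) : k) • v)
    rw [LinearMap.map_smul_of_tower, smul_smul, hc, mul_comm]

end Application

end DerivedSemicont

open DerivedSemicont in
theorem proposition2p3
    {k : Type u} [Field k] [IsAlgClosed k]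
    {A : Type v} [Ring A] [Algebra k A] [Module.Finite k A]
    (I : Ideal A) [I.IsTwoSided] (hI : I ≤ Ring.jacobson A)
    {t : ℕ} (P : Fin t → Type w) [∀ i, AddCommGroup (P i)] [∀ i, Module Aᵐᵒᵖ (P i)]
    [∀ i, Module k (P i)] [∀ i, IsScalarTower k Aᵐᵒᵖ (P i)]
    (hP : IsIndecomposableProjectiveList A P)
    (m n : ℤ) (hmn : m ≤ n) (r : ℤ → Fin t → ℕ) (hr : ∀ l, l ∉ Set.Icc m n → r l = 0)
    (i : ℕ) :
    IsClosed {x : varietyD k P I m n r |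
      topologicalKrullDim {y : varietyD k P I m n r |
        Nonempty (canonicalFamily y ≅ canonicalFamily x)} ≤ (i : WithBot ℕ∞)} := by
  have := hP.finite
  -- Finite generation over a finite dimensional algebra makes the `P j`, and hence all the
  -- homomorphism spaces, finite dimensional over `k`.
  have hA : Module.Finite k Aᵐᵒᵖ := Module.Finite.equiv (MulOpposite.opLinearEquiv k (M := A))
  have hPk : ∀ j, Module.Finite k (P j) := fun j => Module.Finite.trans Aᵐᵒᵖ (P j)
  have hHom : ∀ a b, Module.Finite k (RankModule P a →ₗ[Aᵐᵒᵖ] RankModule P b) := fun a b =>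
    finite_linearMap_of_isScalarTower k
  have hW : Module.Finite k (EndProd (A := A) P m n r) :=
    have (l : Set.Icc m n) : Module.Finite k (Module.End Aᵐᵒᵖ (RankModule P (r l))) := hHom _ _
    Module.Finite.pi
  have h := (diffBimodule k P I m n r).isClosed_topologicalKrullDim_conjClass_le
    (𝔇 := varietyD k P I m n r) conj_smul (fun x hx y => mem_varietyD_of_conj hx) i
  have hset : ∀ x : varietyD k P I m n r, {y : varietyD k P I m n r |
      Nonempty (canonicalFamily y ≅ canonicalFamily x)} =
      (diffBimodule k P I m n r).conjClass x := by
    intro x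
    ext y
    rw [Set.mem_ofPred_eq, Set.mem_ofPred_eq, conj_iff_exists_linearEquiv,
      ← nonempty_iso_canonicalFamily_iff]
    exact ⟨fun ⟨e⟩ => ⟨e.symm⟩, fun ⟨e⟩ => ⟨e.symm⟩⟩
  have hdim : ∀ x : varietyD k P I m n r, topologicalKrullDim {y : varietyD k P I m n r |
      Nonempty (canonicalFamily y ≅ canonicalFamily x)} =
      topologicalKrullDim ((diffBimodule k P I m n r).conjClass x) := fun x => by rw [hset x]
  simp only [hdim]
  exact h
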